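/- Let $G$ be a group. A subgroup $H\le G$ is \emph{almost normal} in $G$ if its normalizer $N_G(H)$ has finite index in $G$, and \emph{nearly normal} in $G$ if $H$ has finite index in its normal closure $H^G$. For a subgroup property $\chi$, the group $G$ satisfies $\mathrm{ac}_\chi$ if it contains no infinite antichain $(H_\lambda)_{\lambda\in\Lambda}$ of subgroups (with respect to inclusion) which are mutually permutable (that is, $H_\lambda H_\mu=H_\mu H_\lambda$ for all $\lambda,\mu\in\Lambda$) and such that 1. $H_\lambda\not\le\langle H_\gamma \mid \gamma\in\Lambda\setminus\{\lambda\}\rangle$ for every $\lambda\in\Lambda$; 2. for every infinite subset $\Lambda_0\subseteq\Lambda$, the join $\langle H_\lambda\mid\lambda\in\Lambda_0\rangle$ is not a $\chi$-subgroup of $G$. Write $\mathrm{ac}_{an}$ and $\mathrm{ac}_{nn}$ for this condition when $\chi$ is almost normality and near normality, respectively. Let $FC(G)$ be the FC-centre of $G$, i.e. the subgroup of all elements having only finitely many conjugates in $G$. The total rank of an abelian group $A$ is $r_0(A)+\sum_p r_p(A)$, where the sum is over all primes $p$, $r_0(A)$ is the torsion-free rank of $A$ (the maximal cardinality of a $\mathbb{Z}$-linearly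 independent subset) and $r_p(A)$ is the $p$-rank (the dimension over $\mathbb{F}_p$ of $\{a\in A : a^p=1\}$). **Theorem.** Let $G$ be a group such that the centre $Z(FC(G))$ of its FC-centre has infinite total rank. - If $G$ satisfies $\mathrm{ac}_{an}$, then $G$ is central-by-finite, i.e. $G/Z(G)$ is finite. - If $G$ satisfies $\mathrm{ac}_{nn}$, then $G$ is finite-by-abelian, i.e. $G$ has a finite normal subgroup $N$ with $G/N$ abelian. -/

import Mathlib

open scoped Pointwise Cardinal IsMulCommutative

/-- A group `G` satisfies the antichain condition for the subgroup property `χ` if there is no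
infinite antichain of mutually permutable subgroups of `G` such that no member is contained in the
join of the other members, and such that no infinite subfamily has a join satisfying `χ`. -/
def AntichainCondition (G : Type*) [Group G] (χ : Subgroup G → Prop) : Prop :=
  ¬ ∃ 𝓗 : Set (Subgroup G),
    𝓗.Infinite ∧
    IsAntichain (· ≤ ·) 𝓗 ∧
    (∀ H ∈ 𝓗, ∀ K ∈ 𝓗, (H : Set G) * (K : Set G) = (K : Set G) * (H : Set G)) ∧
    (∀ H ∈ 𝓗, ¬ H ≤ sSup (𝓗 \ {H})) ∧
    (∀ 𝓗₀ ⊆ 𝓗, 𝓗₀.Infinite → ¬ χ (sSup 𝓗₀))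

/-- `H` is almost normal in `G`: its normalizer has finite index in `G`. -/
def IsAlmostNormal {G : Type*} [Group G] (H : Subgroup G) : Prop :=
  (Subgroup.normalizer (H : Set G)).FiniteIndex

/-- `H` is nearly normal in `G`: it has finite index in its normal closure. -/
def IsNearlyNormal {G : Type*} [Group G] (H : Subgroup G) : Prop :=
  H.IsFiniteRelIndex (Subgroup.normalClosure (H : Set G))

/-- The FC-centre of `G`: the subgroup of all elements with finitely many conjugates. -/
def fcCenter (G : Type*) [Group G] : Subgroup G where
  carrier := {g | (conjugatesOf g).Finite}
  one_mem' := by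
    refine (Set.finite_singleton (1 : G)).subset ?_
    intro x hx
    have h : IsConj 1 x := hx
    exact isConj_one_right.mp h
  mul_mem' := by
    intro a b ha hb
    refine (Set.Finite.mul ha hb).subset ?_
    intro x hx
    obtain ⟨c, rfl⟩ := isConj_iff.mp (show IsConj _ x from hx)
    exact ⟨c * a * c⁻¹, isConj_iff.mpr ⟨c, rfl⟩, c * b * c⁻¹, isConj_iff.mpr ⟨c, rfl⟩,
      by simp [mul_assoc]⟩
  inv_mem' := by
    intro a ha
    refine (Set.Finite.inv ha).subset ?_
    intro x hx
    obtain ⟨c, rfl⟩ := isConj_iff.mp (show IsConj _ x from hx)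
    exact isConj_iff.mpr ⟨c, by simp [mul_assoc]⟩

/-- The torsion-free rank of an abelian group: the maximal cardinality of a `ℤ`-linearly
independent family. -/
noncomputable def torsionFreeRank (A : Type*) [CommGroup A] : Cardinal :=
  Module.rank ℤ (Additive A)

/-- The `p`-rank of an abelian group: the dimension over `𝔽_p` of the subgroup of all elements
killed by `p`. -/
noncomputable def pRank (p : ℕ) (A : Type*) [CommGroup A] : Cardinal :=
  letI : Module (ZMod p) (AddSubgroup.torsionBy (Additive A) (p : ℤ)) :=
    AddSubgroup.torsionBy.zmodModule
  Module.rank (ZMod p) (AddSubgroup.torsionBy (Additive A) (p : ℤ))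

/-- The total rank of an abelian group: the torsion-free rank plus the sum of all `p`-ranks. -/
noncomputable def totalRank (A : Type*) [CommGroup A] : Cardinal :=
  torsionFreeRank A + Cardinal.sum fun p : Nat.Primes => pRank (p : ℕ) A

/-- `G` is central-by-finite: the quotient by its centre is finite. -/
def IsCentralByFinite (G : Type*) [Group G] : Prop :=
  Finite (G ⧸ Subgroup.center G)

/-- `G` is finite-by-abelian: it has a finite normal subgroup with abelian quotient. -/
def IsFiniteByAbelian (G : Type*) [Group G] : Prop :=
  ∃ N : Subgroup G, ∃ _ : N.Normal, Finite N ∧ ∀ a b : G ⧸ N, a * b = b * a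

open scoped commutatorElement



/-! Both properties enter only through `IsTame`: closure under intersection, the fact that a cyclic
subgroup with the property has a generator with finitely many conjugates, and a pigeonhole
principle. The latter says that if `h n` commutes with `g m` for n < m and the subgroup H generated
by the `h n` (n in I) has the property, then infinitely many commutators `⁅h n, g n⁆` lie in one
left coset of H. For almost normality they even lie in H itself.

Every element g has finitely many conjugates. Conjugation acts on V = Z(FC(G)). A greedy sequence
contradicting the pigeonhole principle yields a finite set E such that every element of G fixing E
pointwise sends a into ⟨E⟩⟨a⟩ whenever ⟨a⟩ meets ⟨E⟩ trivially
(`IsTame.exists_finset_forall_mem_sup`). So one power of g fixes all of V if the torsion-free rank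
is infinite, and all of V[p] for each prime p. Infinite total rank then supplies independent
nontrivial g-invariant finitely generated subgroups O_n of V. The subgroups ⟨g⟩O_n form an antichain
of the forbidden shape unless joins over two disjoint infinite index sets have the property; these
joins meet in ⟨g⟩, so ⟨g⟩ has it as well.

The derived subgroup is finite. Otherwise there are pairs (x_n, y_n), commuting across different
indices, with distinct commutators c_n that are central in the group generated by the pairs and of
finite order. Products of powers of the pairs generate an abelian subgroup A, and the pigeonhole
principle puts quotients of powers of different c_n into A. Characters into ℚ/ℤ exclude this: a
character kills the relevant part of A but not the quotient. If finitely many primes divide the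
orders of the c_n, one prime q recurs and long blocks of the x_n are combined
(`CentralPairs.false_of_finite_primes`); otherwise the c_n can be given distinct odd prime orders
(`CentralPairs.false_of_injective_primes`).

This settles near normality. For almost normality, a centre of infinite index would give such pairs
with one common commutator, and the stronger pigeonhole principle is contradicted by blocks of
length two. -/

/-- Greedy construction of a sequence whose terms each satisfy a condition depending on the finite
set of the preceding terms. -/
theorem exists_seq_of_forall_finset {α : Type*} [DecidableEq α] (Q : Finset α → α → Prop)
    (h : ∀ s, ∃ y, Q s y) : ∃ f : ℕ → α, ∀ n, Q ((Finset.range n).image f) (f n) := by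
  choose F hF using h
  let s : ℕ → Finset α := fun n => Nat.rec ∅ (fun _ t => insert (F t) t) n
  have hs : ∀ n, s n = (Finset.range n).image fun n => F (s n) := by
    intro n
    induction n with
    | zero => rfl
    | succ n ih =>
      rw [Finset.range_add_one, Finset.image_insert, ← ih]
  exact ⟨fun n => F (s n), fun n => by rw [← hs]; exact hF _⟩

/-! ### Elements with finitely many conjugates -/

section FC

variable {G : Type*} [Group G]

theorem finiteIndex_centralizer_singleton {g : G} (hg : (conjugatesOf g).Finite) :
    (Subgroup.centralizer {g}).FiniteIndex := by
  have : Finite (conjugatesOf g) := hg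
  let f : G → conjugatesOf g := fun x => ⟨x * g * x⁻¹, isConj_iff.mpr ⟨x, rfl⟩⟩
  have hf : ∀ x y, f x = f y ↔ x⁻¹ * y ∈ Subgroup.centralizer {g} := by
    intro x y
    rw [Subgroup.mem_centralizer_singleton_iff]
    refine Subtype.ext_iff.trans ?_
    change x * g * x⁻¹ = y * g * y⁻¹ ↔ _
    constructor
    · intro h
      calc x⁻¹ * y * g = x⁻¹ * (y * g * y⁻¹) * y := by group
        _ = x⁻¹ * (x * g * x⁻¹) * y := by rw [h]
        _ = g * (x⁻¹ * y) := by group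
    · intro h
      calc x * g * x⁻¹ = x * (g * (x⁻¹ * y)) * y⁻¹ := by group
        _ = x * (x⁻¹ * y * g) * y⁻¹ := by rw [h]
        _ = y * g * y⁻¹ := by group
  have : Finite (G ⧸ Subgroup.centralizer {g}) := by
    refine Finite.of_injective (fun q => f q.out) fun p q hpq => ?_
    have := QuotientGroup.eq.mpr ((hf _ _).mp hpq)
    simpa using this
  exact Subgroup.finiteIndex_of_finite_quotient

theorem finiteIndex_centralizer_of_finite {s : Set G} (hs : s.Finite)
    (h : ∀ g ∈ s, (conjugatesOf g).Finite) : (Subgroup.centralizer s).FiniteIndex := by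
  have : Finite s := hs
  have h1 : Subgroup.centralizer s = ⨅ g : s, Subgroup.centralizer {(g : G)} := by
    ext x
    simp [Subgroup.mem_iInf, Subgroup.mem_centralizer_iff]
  rw [h1]
  have := fun g : s => finiteIndex_centralizer_singleton (h g g.2)
  exact Subgroup.finiteIndex_iInf this

theorem finite_conjugatesOf_of_finiteIndex {g : G} (N : Subgroup G) [N.FiniteIndex]
    (h : {y | ∃ x ∈ N, x * g * x⁻¹ = y}.Finite) : (conjugatesOf g).Finite := by
  refine ((Set.finite_univ (α := G ⧸ N)).image2 (fun q y => q.out * y * q.out⁻¹) h).subset ?_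
  intro y hy
  obtain ⟨x, rfl⟩ := isConj_iff.mp (show IsConj g y from hy)
  refine ⟨(x : G ⧸ N), Set.mem_univ _, ((x : G ⧸ N).out⁻¹ * x) * g * ((x : G ⧸ N).out⁻¹ * x)⁻¹,
    ⟨_, QuotientGroup.eq.mp (by simp), rfl⟩, ?_⟩
  simp only
  group

end FC

/-- Irredundance already makes the members distinct and pairwise incomparable, so for sequences the
antichain clause costs nothing. -/
theorem AntichainCondition.exists_iSup {G : Type*} [Group G] {χ : Subgroup G → Prop}
    (hG : AntichainCondition G χ) (f : ℕ → Subgroup G)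
    (hperm : ∀ m n, (f m : Set G) * (f n : Set G) = (f n : Set G) * (f m : Set G))
    (hirr : ∀ n, ¬ f n ≤ ⨆ m ∈ {m | m ≠ n}, f m) :
    ∃ I : Set ℕ, I.Infinite ∧ χ (⨆ n ∈ I, f n) := by
  by_contra! hcon
  have hle : ∀ m n, f m ≤ f n → m = n := by
    intro m n h
    by_contra hne
    exact hirr m (h.trans (le_biSup f (i := n) (fun e => hne e.symm)))
  have hinj : Function.Injective f := fun m n h => hle m n h.le
  refine hG ⟨Set.range f, Set.infinite_range_of_injective hinj, ?_, ?_, ?_, ?_⟩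
  · rintro _ ⟨m, rfl⟩ _ ⟨n, rfl⟩ hne h
    exact hne (congrArg f (hle m n h))
  · rintro _ ⟨m, rfl⟩ _ ⟨n, rfl⟩
    exact hperm m n
  · rintro _ ⟨n, rfl⟩ h
    refine hirr n (h.trans (sSup_le ?_))
    rintro _ ⟨⟨m, rfl⟩, hm⟩
    exact le_biSup f (i := m) (fun e => hm (congrArg f e))
  · intro 𝓗 h𝓗 hinf
    have h1 : f '' (f ⁻¹' 𝓗) = 𝓗 := Set.image_preimage_eq_of_subset h𝓗
    have h2 := hcon (f ⁻¹' 𝓗) (fun hfin => hinf (h1 ▸ hfin.image f))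
    rwa [← sSup_image, h1] at h2

/-- The properties of almost normality and near normality on which the arguments rely. -/
structure IsTame {G : Type*} [Group G] (χ : Subgroup G → Prop) : Prop where
  inf : ∀ H K, χ H → χ K → χ (H ⊓ K)
  zpowers : ∀ g, χ (Subgroup.zpowers g) → (conjugatesOf g).Finite
  commutator : ∀ (h g : ℕ → G) (I : Set ℕ), I.Infinite →
    (∀ n m, n < m → Commute (h n) (g m)) → χ (Subgroup.closure (h '' I)) →
    ∃ J : Set ℕ, J.Infinite ∧ ∀ n ∈ J, ∀ m ∈ J,
      ⁅h n, g n⁆⁻¹ * ⁅h m, g m⁆ ∈ Subgroup.closure (h '' I)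

theorem Set.Infinite.exists_infinite_fiber {β : Type*} [Finite β] {I : Set ℕ} (hI : I.Infinite)
    (f : ℕ → β) : ∃ b, {n | n ∈ I ∧ f n = b}.Infinite := by
  by_contra! h
  refine hI ((Set.finite_iUnion h).subset fun n hn => ?_)
  exact Set.mem_iUnion.mpr ⟨f n, hn, rfl⟩

/-! ### Almost normality and near normality are tame -/

section AlmostNormal

variable {G : Type*} [Group G]

/-- By pigeonhole on cosets of the normalizer, `g n * (g m)⁻¹` normalizes H for all n, m in an
infinite J. If n < m, conjugation by `g m` fixes `h n`, so conjugation by `g n` keeps `h n` in H.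
The conclusion on single commutators, not only on quotients, is what later separates the almost
normal case. -/
theorem isAlmostNormal_commutator_mem (h g : ℕ → G) (I : Set ℕ) (hI : I.Infinite)
    (hc : ∀ n m, n < m → Commute (h n) (g m))
    (hχ : IsAlmostNormal (Subgroup.closure (h '' I))) :
    ∃ J : Set ℕ, J.Infinite ∧ ∀ n ∈ J, ⁅h n, g n⁆ ∈ Subgroup.closure (h '' I) := by
  set H := Subgroup.closure (h '' I)
  have hfin : (Subgroup.normalizer (H : Set G)).FiniteIndex := hχ
  obtain ⟨b, hb⟩ := hI.exists_infinite_fiber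
    fun n => (((g n)⁻¹ : G) : G ⧸ Subgroup.normalizer (H : Set G))
  refine ⟨_, hb, fun n hn => ?_⟩
  obtain ⟨m, hm, hnm⟩ := hb.exists_gt n
  have h1 : (g n)⁻¹⁻¹ * (g m)⁻¹ ∈ Subgroup.normalizer (H : Set G) :=
    QuotientGroup.eq.mp (hn.2.trans hm.2.symm)
  have hnH : h n ∈ H := Subgroup.subset_closure ⟨n, hn.1, rfl⟩
  have h2 := (Subgroup.mem_normalizer_iff.mp h1 (h n)).mp hnH
  have h3 : (g n)⁻¹⁻¹ * (g m)⁻¹ * h n * ((g n)⁻¹⁻¹ * (g m)⁻¹)⁻¹ = g n * h n * (g n)⁻¹ := by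
    have h4 : (g m)⁻¹ * h n * g m = h n := by
      rw [mul_assoc, (hc n m hnm).eq, inv_mul_cancel_left]
    calc _ = g n * ((g m)⁻¹ * h n * g m) * (g n)⁻¹ := by group
      _ = _ := by rw [h4]
  rw [h3] at h2
  have h5 : ⁅h n, g n⁆ = h n * (g n * h n * (g n)⁻¹)⁻¹ := by rw [commutatorElement_def]; group
  rw [h5]
  exact H.mul_mem hnH (H.inv_mem h2)

/-- Conjugates of g by elements normalizing ⟨g⟩ are generators of ⟨g⟩, and a cyclic group has
finitely many of these. -/
theorem finite_conjugates_in_zpowers (g : G) :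
    {y | y ∈ Subgroup.zpowers g ∧ Subgroup.zpowers y = Subgroup.zpowers g}.Finite := by
  by_cases hg : IsOfFinOrder g
  · have : Finite (Subgroup.zpowers g) := hg.finite_zpowers
    exact (Set.toFinite (Subgroup.zpowers g : Set G)).subset fun y hy => hy.1
  · refine (Set.toFinite {g, g⁻¹}).subset ?_
    rintro y ⟨⟨k, rfl⟩, hy⟩
    obtain ⟨l, hl⟩ : g ∈ Subgroup.zpowers (g ^ k) := hy ▸ Subgroup.mem_zpowers g
    have h1 : g ^ (k * l) = g ^ (1 : ℤ) := by simpa [zpow_mul] using hl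
    have h2 : k * l = 1 := (injective_zpow_iff_not_isOfFinOrder.mpr hg) h1
    rcases Int.eq_one_or_neg_one_of_mul_eq_one h2 with rfl | rfl <;> simp

theorem isTame_isAlmostNormal : IsTame (IsAlmostNormal (G := G)) where
  inf H K hH hK := by
    have h1 : (Subgroup.normalizer (H : Set G)).FiniteIndex := hH
    have h2 : (Subgroup.normalizer (K : Set G)).FiniteIndex := hK
    have h3 : Subgroup.normalizer (H : Set G) ⊓ Subgroup.normalizer (K : Set G) ≤
        Subgroup.normalizer ((H ⊓ K : Subgroup G) : Set G) := by
      intro x hx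
      rw [Subgroup.mem_inf, Subgroup.mem_normalizer_iff, Subgroup.mem_normalizer_iff] at hx
      rw [Subgroup.mem_normalizer_iff]
      intro y
      rw [Subgroup.mem_inf, Subgroup.mem_inf, hx.1 y, hx.2 y]
    change (Subgroup.normalizer ((H ⊓ K : Subgroup G) : Set G)).FiniteIndex
    exact Subgroup.finiteIndex_of_le h3
  zpowers g hg := by
    have h1 : (Subgroup.normalizer (Subgroup.zpowers g : Set G)).FiniteIndex := hg
    refine finite_conjugatesOf_of_finiteIndex
      (Subgroup.normalizer (Subgroup.zpowers g : Set G)) ((finite_conjugates_in_zpowers g).subset ?_)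
    rintro _ ⟨x, hx, rfl⟩
    have h2 := Subgroup.mem_normalizer_iff.mp hx
    have h3 : x * g * x⁻¹ ∈ Subgroup.zpowers g := (h2 g).mp (Subgroup.mem_zpowers g)
    refine ⟨h3, le_antisymm (Subgroup.zpowers_le.mpr h3) (Subgroup.zpowers_le.mpr ?_)⟩
    obtain ⟨k, hk⟩ : x⁻¹ * g * x ∈ Subgroup.zpowers g :=
      (h2 _).mpr (by convert Subgroup.mem_zpowers g using 1; group)
    refine ⟨k, ?_⟩
    simp only [conj_zpow] at hk ⊢
    rw [hk]
    group
  commutator h g I hI hc hχ := by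
    obtain ⟨J, hJ, hJ'⟩ := isAlmostNormal_commutator_mem h g I hI hc hχ
    exact ⟨J, hJ, fun n hn m hm => Subgroup.mul_mem _ (Subgroup.inv_mem _ (hJ' n hn)) (hJ' m hm)⟩

theorem isNearlyNormal_inf {H K : Subgroup G} (hH : IsNearlyNormal H) (hK : IsNearlyNormal K) :
    IsNearlyNormal (H ⊓ K) := by
  unfold IsNearlyNormal at *
  have h1 : Subgroup.normalClosure ((H ⊓ K : Subgroup G) : Set G) ≤ Subgroup.normalClosure (H : Set G) :=
    Subgroup.normalClosure_mono (by simp)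
  have h2 : Subgroup.normalClosure ((H ⊓ K : Subgroup G) : Set G) ≤ Subgroup.normalClosure (K : Set G) :=
    Subgroup.normalClosure_mono (by simp)
  rw [Subgroup.isFiniteRelIndex_iff_relIndex_ne_zero]
  have h3 := Subgroup.isFiniteRelIndex_of_le_right (H := H) h1
  have h4 := Subgroup.isFiniteRelIndex_of_le_right (H := K) h2
  exact Subgroup.relIndex_inf_ne_zero h3.1 h4.1

/-- Let K be the normal closure of ⟨g⟩ and n the index in K of the normal core of ⟨g⟩. The n-th
powers of elements of K lie in ⟨g⟩ and generate an infinite cyclic subgroup ⟨g ^ r⟩ that is normal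
in G. Conjugation can only fix or invert its generator. -/
theorem exists_zpow_eq_of_isFiniteRelIndex {g : G} (hg : ¬ IsOfFinOrder g)
    (h : IsNearlyNormal (Subgroup.zpowers g)) :
    ∃ r : ℤ, r ≠ 0 ∧ ∀ x : G, (x * g * x⁻¹) ^ r = g ^ r ∨ (x * g * x⁻¹) ^ r = g ^ (-r) := by
  set K := Subgroup.normalClosure (Subgroup.zpowers g : Set G)
  have hrel : (Subgroup.zpowers g).IsFiniteRelIndex K := h
  have hgK : g ∈ K := Subgroup.subset_normalClosure (Subgroup.mem_zpowers g)
  set C := ((Subgroup.zpowers g).subgroupOf K).normalCore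
  have hC : C.FiniteIndex := inferInstance
  set n := C.index
  have hn : n ≠ 0 := hC.index_ne_zero
  have hpow : ∀ k ∈ K, k ^ n ∈ Subgroup.zpowers g := by
    intro k hk
    have h1 : (⟨k, hk⟩ : K) ^ n ∈ C := Subgroup.pow_index_mem C _
    exact Subgroup.normalCore_le ((Subgroup.zpowers g).subgroupOf K) h1
  let D : Subgroup G := Subgroup.closure {y | ∃ k ∈ K, k ^ n = y}
  have hD : D ≤ Subgroup.zpowers g := by
    rw [Subgroup.closure_le]
    rintro _ ⟨k, hk, rfl⟩
    exact hpow k hk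
  have hDn : ∀ x, ∀ y ∈ D, x * y * x⁻¹ ∈ D := by
    intro x y hy
    have : D ≤ D.comap (MulAut.conj x).toMonoidHom := by
      rw [Subgroup.closure_le]
      rintro _ ⟨k, hk, rfl⟩
      refine Subgroup.subset_closure ⟨x * k * x⁻¹, ?_, ?_⟩
      · exact (Subgroup.normalClosure_normal).conj_mem k hk x
      · simp [conj_pow]
    exact this hy
  obtain ⟨r, hr⟩ : ∃ r : ℤ, D = Subgroup.zpowers (g ^ r) := by
    obtain ⟨d, hd⟩ := (Subgroup.isCyclic_iff_exists_zpowers_eq_top D).mp (Subgroup.isCyclic_of_le hD)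
    obtain ⟨r, hr⟩ := hD (hd ▸ Subgroup.mem_zpowers d)
    exact ⟨r, by rw [← hd]; simp only at hr; rw [hr]⟩
  have hinj := injective_zpow_iff_not_isOfFinOrder.mpr hg
  have hr0 : r ≠ 0 := by
    rintro rfl
    have h1 : g ^ n ∈ D := Subgroup.subset_closure ⟨g, hgK, rfl⟩
    rw [hr, zpow_zero, Subgroup.zpowers_one_eq_bot, Subgroup.mem_bot] at h1
    exact hg (isOfFinOrder_iff_pow_eq_one.mpr ⟨n, Nat.pos_of_ne_zero hn, h1⟩)
  refine ⟨r, hr0, fun x => ?_⟩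
  have key : ∀ x : G, ∃ k : ℤ, x * g ^ r * x⁻¹ = g ^ (r * k) := by
    intro x
    have h1 := hDn x (g ^ r) (hr ▸ Subgroup.mem_zpowers _)
    rw [hr] at h1
    obtain ⟨k, hk⟩ := h1
    exact ⟨k, by rw [← hk, zpow_mul]⟩
  obtain ⟨k, hk⟩ := key x
  obtain ⟨l, hl⟩ := key x⁻¹
  have h2 : g ^ (r * (k * l)) = g ^ r := by
    calc g ^ (r * (k * l)) = (g ^ (r * l)) ^ k := by rw [← zpow_mul]; ring_nf
      _ = x⁻¹ * (x * g ^ r * x⁻¹) * x := by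
        rw [← hl, inv_inv, hk]
        have := conj_zpow (i := k) (a := x⁻¹) (b := g ^ r)
        rw [inv_inv] at this
        rw [this, ← zpow_mul]
      _ = g ^ r := by group
  have h3 : k * l = 1 := by
    have := hinj h2
    exact mul_left_cancel₀ hr0 (by simpa using this)
  rw [conj_zpow, hk]
  rcases Int.eq_one_or_neg_one_of_mul_eq_one h3 with rfl | rfl <;> simp

theorem isTame_isNearlyNormal : IsTame (IsNearlyNormal (G := G)) where
  inf H K hH hK := isNearlyNormal_inf hH hK
  zpowers g h := by
    have hrel : (Subgroup.zpowers g).IsFiniteRelIndex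
      (Subgroup.normalClosure (Subgroup.zpowers g : Set G)) := h
    set K := Subgroup.normalClosure (Subgroup.zpowers g : Set G)
    have hgK : g ∈ K := Subgroup.subset_normalClosure (Subgroup.mem_zpowers g)
    have hK : ∀ y ∈ conjugatesOf g, y ∈ K := by
      intro y hy
      obtain ⟨x, rfl⟩ := isConj_iff.mp (show IsConj g y from hy)
      exact (Subgroup.normalClosure_normal).conj_mem g hgK x
    by_cases hg : IsOfFinOrder g
    · have : Finite (Subgroup.zpowers g) := hg.finite_zpowers
      have h1 : Finite ((Subgroup.zpowers g).subgroupOf K) :=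
        Finite.of_injective (fun y => (⟨y.1.1, y.2⟩ : Subgroup.zpowers g)) fun a b hab =>
          Subtype.ext (Subtype.ext (congrArg (fun t : Subgroup.zpowers g => (t : G)) hab))
      have h2 : Finite K := by
        have h3 : Finite (K ⧸ (Subgroup.zpowers g).subgroupOf K) := inferInstance
        exact Finite.of_equiv _ (Subgroup.groupEquivQuotientProdSubgroup
          (s := (Subgroup.zpowers g).subgroupOf K)).symm
      exact (Set.toFinite (K : Set G)).subset hK
    · obtain ⟨r, hr, hconj⟩ := exists_zpow_eq_of_isFiniteRelIndex hg h
      have hinj := injective_zpow_iff_not_isOfFinOrder.mpr hg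
      have hcoset : ∀ y : K, ∃ k : ℤ,
          g ^ k = ((y : K ⧸ (Subgroup.zpowers g).subgroupOf K).out⁻¹ * y : K) := by
        intro y
        have h1 : (y : K ⧸ (Subgroup.zpowers g).subgroupOf K).out⁻¹ * y ∈
            (Subgroup.zpowers g).subgroupOf K := QuotientGroup.eq.mp (QuotientGroup.out_eq' _)
        exact h1
      choose k hk using hcoset
      have : NeZero r.natAbs := ⟨by simpa using hr⟩
      classical
      -- A conjugate is determined by its coset modulo ⟨g⟩, the exponent of its ⟨g⟩-part modulo r,
      -- and whether its r-th power is `g ^ r` or `g ^ (-r)`. If y and z share these data, then z =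
      -- y * g ^ (r * j) and y, z have equal r-th powers; as y commutes with `g ^ r`, this forces j
      -- = 0.
      let f : conjugatesOf g → (K ⧸ (Subgroup.zpowers g).subgroupOf K) × ZMod r.natAbs × Prop :=
        fun y => ((⟨y, hK y y.2⟩ : K), (k ⟨y, hK y y.2⟩ : ZMod r.natAbs), (y : G) ^ r = g ^ r)
      refine Set.finite_coe_iff.mp (Finite.of_injective f ?_)
      rintro ⟨y, hy⟩ ⟨z, hz⟩ h
      simp only [f, Prod.mk.injEq, eq_iff_iff] at h
      obtain ⟨h1, h2, h3⟩ := h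
      have h4 := hk ⟨y, hK y hy⟩
      have h5 := hk ⟨z, hK z hz⟩
      rw [← h1] at h5
      rw [ZMod.intCast_eq_intCast_iff_dvd_sub] at h2
      obtain ⟨j, hj⟩ : r ∣ _ := Int.natAbs_dvd.mp h2
      have h6 : z = y * (g ^ r) ^ j := by
        rw [← zpow_mul, ← hj, zpow_sub, h4, h5]
        have h7 : Commute (g ^ k ⟨z, hK z hz⟩) (g ^ k ⟨y, hK y hy⟩)⁻¹ :=
          ((Commute.refl g).zpow_zpow _ _).inv_right
        rw [h4, h5] at h7
        rw [h7.eq]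
        simp only [Subgroup.coe_mul, mul_inv_rev, Subgroup.coe_inv, inv_inv, mul_assoc,
          mul_inv_cancel_left]
      obtain ⟨x, hx⟩ := isConj_iff.mp (show IsConj g y from hy)
      obtain ⟨x', hx'⟩ := isConj_iff.mp (show IsConj g z from hz)
      have hyr := hconj x
      have hzr := hconj x'
      rw [hx] at hyr
      rw [hx'] at hzr
      have h8 : z ^ r = y ^ r := by
        by_cases h9 : y ^ r = g ^ r
        · rw [h9, h3.mp h9]
        · rw [hyr.resolve_left h9, hzr.resolve_left (fun e => h9 (h3.mpr e))]
      have h9 : Commute y (g ^ r) := by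
        rcases hyr with e | e
        · rw [← e]; exact (Commute.refl y).zpow_right r
        · have h10 := ((Commute.refl y).zpow_right r).inv_right
          rwa [e, zpow_neg, inv_inv] at h10
      have h11 : ((g ^ r) ^ j) ^ r = 1 := by
        rw [h6, (h9.zpow_right j).mul_zpow] at h8
        simpa using h8
      have h12 : g ^ (r * j * r) = g ^ (0 : ℤ) := by rw [zpow_mul, zpow_mul, h11, zpow_zero]
      have h13 : j = 0 := by
        have := hinj h12
        simpa [hr] using this
      rw [Subtype.mk.injEq, h6, h13, zpow_zero, mul_one]
  commutator h g I hI hc hχ := by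
    set H := Subgroup.closure (h '' I)
    set K := Subgroup.normalClosure (H : Set G)
    have hrel : H.IsFiniteRelIndex K := hχ
    have hHK : H ≤ K := Subgroup.le_normalClosure
    have hmem : ∀ n ∈ I, ⁅h n, g n⁆ ∈ K := by
      intro n hn
      have h1 : h n ∈ K := hHK (Subgroup.subset_closure ⟨n, hn, rfl⟩)
      have h2 : ⁅h n, g n⁆ = h n * (g n * (h n)⁻¹ * (g n)⁻¹) := by
        rw [commutatorElement_def]; group
      rw [h2]
      exact K.mul_mem h1 ((Subgroup.normalClosure_normal).conj_mem _ (K.inv_mem h1) _)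
    classical
    -- The commutators lie in K, where H has finitely many cosets. The value 1 outside I is harmless
    -- because the fibre is taken inside I.
    obtain ⟨b, hb⟩ := hI.exists_infinite_fiber fun n =>
      ((if hn : n ∈ I then (⟨⁅h n, g n⁆, hmem n hn⟩ : K) else 1 : K) : K ⧸ H.subgroupOf K)
    refine ⟨_, hb, fun n hn m hm => ?_⟩
    have h1 := QuotientGroup.eq.mp (hn.2.trans hm.2.symm)
    rw [dif_pos hn.1, dif_pos hm.1] at h1
    exact h1

end AlmostNormal


/-! ### Sequences of commuting elements generating irredundant cyclic subgroups -/

section Commutators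

variable {G : Type*} [Group G]

theorem zpowers_mul_zpowers_comm {a b : G} (h : Commute a b) :
    (Subgroup.zpowers a : Set G) * (Subgroup.zpowers b : Set G) =
      (Subgroup.zpowers b : Set G) * (Subgroup.zpowers a : Set G) := by
  ext x
  constructor
  · rintro ⟨_, ⟨k, rfl⟩, _, ⟨l, rfl⟩, rfl⟩
    exact ⟨b ^ l, ⟨l, rfl⟩, a ^ k, ⟨k, rfl⟩, (h.zpow_zpow k l).eq.symm⟩
  · rintro ⟨_, ⟨k, rfl⟩, _, ⟨l, rfl⟩, rfl⟩
    exact ⟨a ^ l, ⟨l, rfl⟩, b ^ k, ⟨k, rfl⟩, (h.zpow_zpow l k).eq⟩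

theorem AntichainCondition.exists_closure {χ : Subgroup G → Prop} (hG : AntichainCondition G χ)
    (h : ℕ → G) (hh : ∀ m n, Commute (h m) (h n))
    (hirr : ∀ n, h n ∉ Subgroup.closure (h '' {m | m ≠ n})) :
    ∃ I : Set ℕ, I.Infinite ∧ χ (Subgroup.closure (h '' I)) := by
  have key : ∀ I : Set ℕ, ⨆ n ∈ I, Subgroup.zpowers (h n) = Subgroup.closure (h '' I) := by
    intro I
    simp only [Subgroup.zpowers_eq_closure, ← Subgroup.closure_iUnion]
    congr 1
    ext
    simp [eq_comm]
  obtain ⟨I, hI, hI'⟩ := hG.exists_iSup (fun n => Subgroup.zpowers (h n))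
    (fun m n => zpowers_mul_zpowers_comm (hh m n)) (fun n hn => by
      rw [key] at hn
      exact hirr n (hn (Subgroup.mem_zpowers _)))
  exact ⟨I, hI, key I ▸ hI'⟩

theorem IsTame.exists_commutator_mem {χ : Subgroup G → Prop} (hχ : IsTame χ)
    (hG : AntichainCondition G χ) (h g : ℕ → G) (hh : ∀ m n, Commute (h m) (h n))
    (hirr : ∀ n, h n ∉ Subgroup.closure (h '' {m | m ≠ n}))
    (hc : ∀ n m, n < m → Commute (h n) (g m)) :
    ∃ J : Set ℕ, J.Infinite ∧ ∀ n ∈ J, ∀ m ∈ J,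
      ⁅h n, g n⁆⁻¹ * ⁅h m, g m⁆ ∈ Subgroup.closure (Set.range h) := by
  obtain ⟨I, hI, hI'⟩ := hG.exists_closure h hh hirr
  obtain ⟨J, hJ, hJ'⟩ := hχ.commutator h g I hI hc hI'
  exact ⟨J, hJ, fun n hn m hm =>
    Subgroup.closure_mono (Set.image_subset_range h I) (hJ' n hn m hm)⟩

theorem exists_commutator_mem_of_isAlmostNormal (hG : AntichainCondition G IsAlmostNormal)
    (h g : ℕ → G) (hh : ∀ m n, Commute (h m) (h n))
    (hirr : ∀ n, h n ∉ Subgroup.closure (h '' {m | m ≠ n}))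
    (hc : ∀ n m, n < m → Commute (h n) (g m)) :
    ∃ n, ⁅h n, g n⁆ ∈ Subgroup.closure (Set.range h) := by
  obtain ⟨I, hI, hI'⟩ := hG.exists_closure h hh hirr
  obtain ⟨J, hJ, hJ'⟩ := isAlmostNormal_commutator_mem h g I hI hc hI'
  obtain ⟨n, hn⟩ := hJ.nonempty
  exact ⟨n, Subgroup.closure_mono (Set.image_subset_range h I) (hJ' n hn)⟩

/-- An element outside the centraliser of `y` does not lie in a subgroup generated by elements that
commute with `y`. -/
theorem notMem_closure_of_not_commute {h : ℕ → G} {y : G} {n : ℕ} (hn : ¬ Commute (h n) y)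
    (hm : ∀ m, m ≠ n → Commute (h m) y) : h n ∉ Subgroup.closure (h '' {m | m ≠ n}) := by
  intro hmem
  have : Subgroup.closure (h '' {m | m ≠ n}) ≤ Subgroup.centralizer {y} := by
    rw [Subgroup.closure_le]
    rintro _ ⟨m, hmn, rfl⟩
    exact Subgroup.mem_centralizer_singleton_iff.mpr (hm m hmn).eq
  exact hn (Subgroup.mem_centralizer_singleton_iff.mp (this hmem))

end Commutators

/-! ### A finite set controlling the action on an abelian normal subgroup -/

section SequenceLemma

/-- Generators of index at least m are stripped off from the top. If `a j` is the last one
occurring, all other factors and x lie in `W j`, hence so does the power of `a j`, which is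
therefore trivial. -/
theorem mem_sup_closure_of_lt {V : Type*} [CommGroup V] (a : ℕ → V) (W : ℕ → Subgroup V)
    (hW : Monotone W) (ha : ∀ n, a n ∈ W (n + 1)) (hind : ∀ n (k : ℤ), a n ^ k ∈ W n → a n ^ k = 1)
    (X : Subgroup V) (m : ℕ) (hX : X ≤ W m) (S : Set ℕ) (x : V) (hx : x ∈ W m)
    (hx' : x ∈ X ⊔ Subgroup.closure (a '' S)) :
    x ∈ X ⊔ Subgroup.closure (a '' {i | i ∈ S ∧ i < m}) := by
  have h1 : ∃ j, m ≤ j ∧ x ∈ X ⊔ Subgroup.closure (a '' {i | i ∈ S ∧ i < j}) := by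
    obtain ⟨u, hu, w, hw, rfl⟩ := Subgroup.mem_sup.mp hx'
    have : ∃ j, w ∈ Subgroup.closure (a '' {i | i ∈ S ∧ i < j}) := by
      clear hx hx'
      have hmono : ∀ j k, j ≤ k → Subgroup.closure (a '' {i | i ∈ S ∧ i < j}) ≤
          Subgroup.closure (a '' {i | i ∈ S ∧ i < k}) := fun j k hjk =>
        Subgroup.closure_mono (Set.image_mono fun i hi => ⟨hi.1, hi.2.trans_le hjk⟩)
      induction hw using Subgroup.closure_induction with
      | mem x hx =>
        obtain ⟨i, hi, rfl⟩ := hx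
        exact ⟨i + 1, Subgroup.subset_closure ⟨i, ⟨hi, by simp⟩, rfl⟩⟩
      | one => exact ⟨0, Subgroup.one_mem _⟩
      | mul y z _ _ hy hz =>
        obtain ⟨j, hj⟩ := hy
        obtain ⟨k, hk⟩ := hz
        exact ⟨max j k, Subgroup.mul_mem _ (hmono _ _ (le_max_left _ _) hj)
          (hmono _ _ (le_max_right _ _) hk)⟩
      | inv y _ hy =>
        obtain ⟨j, hj⟩ := hy
        exact ⟨j, Subgroup.inv_mem _ hj⟩
    obtain ⟨j, hj⟩ := this
    refine ⟨max m j, le_max_left _ _, Subgroup.mem_sup.mpr ⟨u, hu, w, ?_, rfl⟩⟩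
    refine Subgroup.closure_mono (Set.image_mono ?_) hj
    exact fun i hi => ⟨hi.1, hi.2.trans_le (le_max_right _ _)⟩
  obtain ⟨j, hmj, hj⟩ := h1
  induction j, hmj using Nat.le_induction with
  | base => exact hj
  | succ j hmj ih =>
    apply ih
    by_cases hjS : j ∈ S
    · have h2 : {i | i ∈ S ∧ i < j + 1} = insert j {i | i ∈ S ∧ i < j} := by
        ext i
        simp only [Set.mem_ofPred_eq, Set.mem_insert_iff]
        constructor
        · rintro ⟨h, h'⟩
          rcases Nat.lt_succ_iff_lt_or_eq.mp h' with h' | h'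
          · exact Or.inr ⟨h, h'⟩
          · exact Or.inl h'
        · rintro (rfl | ⟨h, h'⟩)
          · exact ⟨hjS, by simp⟩
          · exact ⟨h, by omega⟩
      rw [h2, Set.image_insert_eq, Set.insert_eq, Subgroup.closure_union, ← Subgroup.zpowers_eq_closure,
        sup_left_comm] at hj
      obtain ⟨_, ⟨k, rfl⟩, w, hw, rfl⟩ := Subgroup.mem_sup.mp hj
      have h3 : X ⊔ Subgroup.closure (a '' {i | i ∈ S ∧ i < j}) ≤ W j := by
        refine sup_le (hX.trans (hW hmj)) ?_
        rw [Subgroup.closure_le]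
        rintro _ ⟨i, hi, rfl⟩
        exact hW (Nat.succ_le_of_lt hi.2) (ha i)
      have h4 : a j ^ k ∈ W j := by
        have := (W j).mul_mem (hW hmj hx) ((W j).inv_mem (h3 hw))
        simpa using this
      simp only [hind j k h4, one_mul]
      exact hw
    · have h2 : {i | i ∈ S ∧ i < j + 1} = {i | i ∈ S ∧ i < j} := by
        ext i
        simp only [Set.mem_ofPred_eq]
        constructor
        · rintro ⟨h, h'⟩
          refine ⟨h, lt_of_le_of_ne (by omega) ?_⟩
          rintro rfl
          exact hjS h
        · rintro ⟨h, h'⟩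
          exact ⟨h, by omega⟩
      rwa [h2] at hj

variable {G V : Type*} [Group G] [CommGroup V] {ι : V →* G} {ρ : G →* MulAut V}

/-- If no finite set worked, one could choose successively `a n` independent of the earlier data and
`g n` fixing those data but moving `a n` outside their span with ⟨a n⟩. The cyclic groups ⟨a n⟩ are
then irredundant, and the pigeonhole principle applies to the commutators of `a n` with `g n`. -/
theorem IsTame.exists_finset_forall_mem_sup {χ : Subgroup G → Prop} (hχ : IsTame χ)
    (hG : AntichainCondition G χ) (hι : Function.Injective ι)
    (hρ : ∀ g v, ι (ρ g v) = g * ι v * g⁻¹) :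
    ∃ E : Finset V, ∀ a : V, (∀ n : ℤ, a ^ n ∈ Subgroup.closure (E : Set V) → a ^ n = 1) →
      ∀ g, (∀ e ∈ E, ρ g e = e) →
        ρ g a ∈ Subgroup.closure (E : Set V) ⊔ Subgroup.zpowers a := by
  classical
  by_contra! hcon
  -- The images `ρ (g m) (a m)` are recorded together with the `a m`, so that earlier commutators
  -- lie in `W n`.
  let E : Finset (V × G) → Finset V := fun s => s.image Prod.fst ∪ s.image fun p => ρ p.2 p.1
  obtain ⟨f, hf⟩ := exists_seq_of_forall_finset (α := V × G)
    (fun s p => (∀ n : ℤ, p.1 ^ n ∈ Subgroup.closure (E s : Set V) → p.1 ^ n = 1) ∧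
      (∀ e ∈ E s, ρ p.2 e = e) ∧
      ρ p.2 p.1 ∉ Subgroup.closure (E s : Set V) ⊔ Subgroup.zpowers p.1) (fun s => by
        obtain ⟨a, ha, g, hg, hag⟩ := hcon (E s)
        exact ⟨(a, g), ha, hg, hag⟩)
  set a : ℕ → V := fun n => (f n).1
  set g : ℕ → G := fun n => (f n).2
  set s : ℕ → Finset (V × G) := fun n => (Finset.range n).image f
  set W : ℕ → Subgroup V := fun n => Subgroup.closure (E (s n) : Set V)
  have hEmem : ∀ m n, m < n → a m ∈ E (s n) ∧ ρ (g m) (a m) ∈ E (s n) := by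
    intro m n hmn
    have h1 : f m ∈ s n := Finset.mem_image_of_mem f (Finset.mem_range.mpr hmn)
    exact ⟨Finset.mem_union_left _ (Finset.mem_image_of_mem _ h1),
      Finset.mem_union_right _ (Finset.mem_image_of_mem (fun p : V × G => ρ p.2 p.1) h1)⟩
  have hW : Monotone W := by
    intro m n hmn
    refine Subgroup.closure_mono ?_
    have : s m ⊆ s n := Finset.image_subset_image (Finset.range_mono hmn)
    exact_mod_cast Finset.union_subset_union (Finset.image_subset_image this)
      (Finset.image_subset_image this)
  have ha : ∀ n, a n ∈ W (n + 1) := fun n => Subgroup.subset_closure (hEmem n _ n.lt_succ_self).1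
  have hga : ∀ n, ρ (g n) (a n) ∈ W (n + 1) :=
    fun n => Subgroup.subset_closure (hEmem n _ n.lt_succ_self).2
  have hind : ∀ n (k : ℤ), a n ^ k ∈ W n → a n ^ k = 1 := fun n => (hf n).1
  have hfix : ∀ n, ∀ e ∈ E (s n), ρ (g n) e = e := fun n => (hf n).2.1
  have hnot : ∀ n, ρ (g n) (a n) ∉ W n ⊔ Subgroup.zpowers (a n) := fun n => (hf n).2.2
  have hmap : ∀ S : Set ℕ, Subgroup.closure ((fun n => ι (a n)) '' S) =
      (Subgroup.closure (a '' S)).map ι := by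
    intro S
    rw [MonoidHom.map_closure, Set.image_image]
  have hirr : ∀ n, a n ∉ Subgroup.closure (a '' {m | m ≠ n}) := by
    intro n hn
    have h1 := mem_sup_closure_of_lt a W hW ha hind ⊥ (n + 1) bot_le {m | m ≠ n} (a n) (ha n)
      (by rwa [bot_sup_eq])
    rw [bot_sup_eq] at h1
    have h2 : Subgroup.closure (a '' {i | i ∈ {m | m ≠ n} ∧ i < n + 1}) ≤ W n := by
      rw [Subgroup.closure_le]
      rintro _ ⟨i, ⟨hi, hi'⟩, rfl⟩
      exact hW (Nat.succ_le_of_lt (lt_of_le_of_ne (Nat.lt_succ_iff.mp hi') hi)) (ha i)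
    have h3 : a n = 1 := by
      have := hind n 1 (by rw [zpow_one]; exact h2 h1)
      rwa [zpow_one] at this
    apply hnot n
    rw [h3, map_one]
    exact Subgroup.one_mem _
  obtain ⟨J, hJ, hJ'⟩ := hχ.exists_commutator_mem hG (fun n => ι (a n)) g
    (fun m n => (Commute.all (a m) (a n)).map ι) (fun n hn => by
      rw [hmap] at hn
      obtain ⟨y, hy, hyn⟩ := hn
      exact hirr n (hι hyn ▸ hy)) (fun n m hnm => by
      have h1 := congrArg ι (hfix m _ (hEmem n m hnm).1)
      rw [hρ] at h1
      exact (mul_inv_eq_iff_eq_mul.mp h1).symm)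
  obtain ⟨n, hn⟩ := hJ.nonempty
  obtain ⟨m, hm, hnm⟩ := hJ.exists_gt n
  have h1 : ∀ n, ⁅ι (a n), g n⁆ = ι (a n * (ρ (g n) (a n))⁻¹) := by
    intro n
    rw [map_mul, map_inv, hρ, commutatorElement_def]
    group
  have h2 := hJ' n hn m hm
  rw [h1, h1, ← map_inv, ← map_mul, ← Set.image_univ, hmap] at h2
  obtain ⟨y, hy, hyn⟩ := h2
  have h3 := hι hyn
  -- For n < m the commutator of index n is absorbed by `W m`. The image of `a m` is thus in the
  -- span of `W m` and all the `a i`; truncating at index m leaves `W m` and ⟨a m⟩, contrary to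
  -- `hnot`.
  have h4 : a n * (ρ (g n) (a n))⁻¹ ∈ W m :=
    hW (Nat.succ_le_of_lt hnm) ((W (n + 1)).mul_mem (ha n) ((W (n + 1)).inv_mem (hga n)))
  have h5 : a m * (ρ (g m) (a m))⁻¹ ∈ W m ⊔ Subgroup.closure (a '' Set.univ) :=
    Subgroup.mem_sup.mpr ⟨_, h4, y, hy, by rw [h3, mul_inv_cancel_left]⟩
  have h6 : (ρ (g m) (a m)) ∈ W m ⊔ Subgroup.closure (a '' Set.univ) := by
    have h7 : a m ∈ W m ⊔ Subgroup.closure (a '' Set.univ) :=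
      Subgroup.mem_sup_right (Subgroup.subset_closure ⟨m, trivial, rfl⟩)
    have := Subgroup.mul_mem _ (Subgroup.inv_mem _ h5) h7
    simpa using this
  have h8 := mem_sup_closure_of_lt a W hW ha hind (W m) (m + 1) (hW m.le_succ) Set.univ _ (hga m) h6
  refine hnot m ((sup_le le_sup_left ?_ : _ ≤ W m ⊔ Subgroup.zpowers (a m)) h8)
  rw [Subgroup.closure_le]
  rintro _ ⟨i, ⟨-, hi⟩, rfl⟩
  rcases Nat.lt_succ_iff_lt_or_eq.mp hi with hi | rfl
  · exact Subgroup.mem_sup_left (hW (Nat.succ_le_of_lt hi) (ha i))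
  · exact Subgroup.mem_sup_right (Subgroup.mem_zpowers _)

end SequenceLemma


theorem iSupIndep_of_disjoint_of_lt {α : Type*} [CompleteLattice α] [IsModularLattice α]
    [IsCompactlyGenerated α] (t U : ℕ → α) (hU : Monotone U) (htU : ∀ n, t n ≤ U (n + 1))
    (hdisj : ∀ n, Disjoint (t n) (U n)) : iSupIndep t := by
  classical
  rw [iSupIndep_iff_supIndep]
  intro s
  induction s using Finset.induction_on_max with
  | empty => exact Finset.supIndep_empty t
  | insert n s hs ih =>
    refine ih.insert ((hdisj n).mono_right (Finset.sup_le fun m hm => ?_))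
    exact (htU m).trans (hU (Nat.succ_le_of_lt (hs m hm)))

/-- Cyclic subgroups are compact elements. This makes the preceding independence criterion available
for subgroups of an abelian group. -/
instance Subgroup.instIsCompactlyGenerated {V : Type*} [Group V] :
    IsCompactlyGenerated (Subgroup V) where
  exists_sSup_eq H := by
    refine ⟨{K | ∃ v ∈ H, Subgroup.zpowers v = K}, ?_, ?_⟩
    · rintro _ ⟨v, -, rfl⟩
      rw [CompleteLattice.isCompactElement_iff_le_of_directed_sSup_le]
      intro s hs hdir hle
      obtain ⟨K, hK, hv⟩ := (Subgroup.mem_sSup_of_directedOn hs hdir).mp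
        (hle (Subgroup.mem_zpowers v))
      exact ⟨K, hK, Subgroup.zpowers_le.mpr hv⟩
    · refine le_antisymm (sSup_le ?_) fun v hv => ?_
      swap
      · have : Subgroup.zpowers v ∈ {K | ∃ v ∈ H, Subgroup.zpowers v = K} := ⟨v, hv, rfl⟩
        exact le_sSup this (Subgroup.mem_zpowers v)
      rintro _ ⟨v, hv, rfl⟩
      exact Subgroup.zpowers_le.mpr hv

/-! ### Finiteness of a conjugacy class from independent invariant subgroups -/

section CyclicExtension

variable {G V : Type*} [Group G] [CommGroup V] {ι : V →* G} {ρ : G →* MulAut V}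

theorem mem_zpowers_sup_map (hρ : ∀ g v, ι (ρ g v) = g * ι v * g⁻¹) {g : G} {X : Subgroup V}
    (hX : ∀ (k : ℤ), ∀ v ∈ X, ρ (g ^ k) v ∈ X) {x : G} :
    x ∈ Subgroup.zpowers g ⊔ X.map ι ↔ ∃ (k : ℤ), ∃ u ∈ X, x = g ^ k * ι u := by
  have hcomm : ∀ (k : ℤ) (u : V), ι u * g ^ k = g ^ k * ι (ρ (g ^ (-k)) u) := by
    intro k u
    rw [hρ]
    group
  constructor
  · intro hx
    let D : Subgroup G :=
      { carrier := {x | ∃ (k : ℤ), ∃ u ∈ X, x = g ^ k * ι u}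
        one_mem' := ⟨0, 1, X.one_mem, by simp⟩
        mul_mem' := by
          rintro _ _ ⟨k, u, hu, rfl⟩ ⟨l, w, hw, rfl⟩
          refine ⟨k + l, ρ (g ^ (-l)) u * w, X.mul_mem (hX _ _ hu) hw, ?_⟩
          calc g ^ k * ι u * (g ^ l * ι w) = g ^ k * (ι u * g ^ l) * ι w := by group
            _ = _ := by rw [hcomm, map_mul, zpow_add]; group
        inv_mem' := by
          rintro _ ⟨k, u, hu, rfl⟩
          refine ⟨-k, ρ (g ^ (- -k)) u⁻¹, hX _ _ (X.inv_mem hu), ?_⟩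
          rw [← hcomm, mul_inv_rev, map_inv, zpow_neg] }
    have hD : Subgroup.zpowers g ⊔ X.map ι ≤ D := by
      refine sup_le ?_ ?_
      · rw [Subgroup.zpowers_le]
        exact ⟨1, 1, X.one_mem, by simp⟩
      · rintro _ ⟨u, hu, rfl⟩
        exact ⟨0, u, hu, by simp⟩
    exact hD hx
  · rintro ⟨k, u, hu, rfl⟩
    exact Subgroup.mul_mem _ (Subgroup.mem_sup_left ⟨k, rfl⟩) (Subgroup.mem_sup_right ⟨u, hu, rfl⟩)

/-- Invariance makes the groups ⟨g⟩O_n permutable, and independence modulo ⟨g⟩ ∩ V makes them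
irredundant. Joins over disjoint index sets have the form ⟨g⟩A and ⟨g⟩B, and independence gives ⟨g⟩A
∩ ⟨g⟩B = ⟨g⟩. -/
theorem IsTame.finite_conjugatesOf_of_iSupIndep {χ : Subgroup G → Prop} (hχ : IsTame χ)
    (hG : AntichainCondition G χ)
    (hρ : ∀ g v, ι (ρ g v) = g * ι v * g⁻¹) (g : G) (O : ℕ → Subgroup V) (hO : ∀ n, O n ≠ ⊥)
    (hinv : ∀ n (k : ℤ), ∀ v ∈ O n, ρ (g ^ k) v ∈ O n)
    (hind : ∀ I J : Set ℕ, Disjoint I J →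
      Disjoint (((Subgroup.zpowers g).comap ι) ⊔ ⨆ n ∈ I, O n) (⨆ n ∈ J, O n)) :
    (conjugatesOf g).Finite := by
  have hinvS : ∀ (I : Set ℕ) (k : ℤ), ∀ v ∈ ⨆ n ∈ I, O n, ρ (g ^ k) v ∈ ⨆ n ∈ I, O n := by
    intro I k
    have : ⨆ n ∈ I, O n ≤ (⨆ n ∈ I, O n).comap (ρ (g ^ k)).toMonoidHom :=
      iSup₂_le fun n hn v hv => Subgroup.mem_iSup_of_mem n
        (Subgroup.mem_iSup_of_mem hn (hinv n k v hv))
    exact this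
  have hjoin : ∀ I : Set ℕ, I.Nonempty → ⨆ n ∈ I, (Subgroup.zpowers g ⊔ (O n).map ι) =
      Subgroup.zpowers g ⊔ (⨆ n ∈ I, O n).map ι := by
    intro I hI
    simp only [Subgroup.map_iSup]
    refine le_antisymm (iSup₂_le fun n hn => sup_le_sup_left (le_biSup (fun n => (O n).map ι) hn) _)
      (sup_le ?_ (iSup₂_le fun n hn => le_sup_right.trans
        (le_biSup (fun n => Subgroup.zpowers g ⊔ (O n).map ι) hn)))
    obtain ⟨n, hn⟩ := hI
    exact le_sup_left.trans (le_biSup (fun n => Subgroup.zpowers g ⊔ (O n).map ι) hn)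
  have hcancel : ∀ (k l : ℤ) (u w : V), g ^ k * ι u = g ^ l * ι w →
      w * u⁻¹ ∈ (Subgroup.zpowers g).comap ι := by
    intro k l u w h
    refine ⟨k - l, ?_⟩
    simp only [map_mul, map_inv]
    rw [zpow_sub, (Commute.zpow_zpow_self g k l).inv_right.eq, eq_mul_inv_iff_mul_eq, mul_assoc, h,
      inv_mul_cancel_left]
  have hsub : ∀ φ : ℕ → ℕ, Function.Injective φ → ∃ I : Set ℕ, I.Nonempty ∧
      χ (Subgroup.zpowers g ⊔ (⨆ n ∈ φ '' I, O n).map ι) := by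
    intro φ hφ
    have hperm : ∀ m n, ((Subgroup.zpowers g ⊔ (O (φ m)).map ι : Subgroup G) : Set G) *
        ((Subgroup.zpowers g ⊔ (O (φ n)).map ι : Subgroup G) : Set G) =
        ((Subgroup.zpowers g ⊔ (O (φ n)).map ι : Subgroup G) : Set G) *
        ((Subgroup.zpowers g ⊔ (O (φ m)).map ι : Subgroup G) : Set G) := by
      intro m n
      have : ∀ m n, (Subgroup.zpowers g ⊔ (O (φ m)).map ι : Subgroup G) *
          ((Subgroup.zpowers g ⊔ (O (φ n)).map ι : Subgroup G) : Set G) ⊆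
          ((Subgroup.zpowers g ⊔ (O (φ n)).map ι : Subgroup G) : Set G) *
            (Subgroup.zpowers g ⊔ (O (φ m)).map ι : Subgroup G) := by
        rintro m n _ ⟨x, hx, y, hy, rfl⟩
        obtain ⟨k, u, hu, rfl⟩ := (mem_zpowers_sup_map hρ (hinv _)).mp hx
        obtain ⟨l, w, hw, rfl⟩ := (mem_zpowers_sup_map hρ (hinv _)).mp hy
        refine ⟨g ^ (k + l) * ι w, (mem_zpowers_sup_map hρ (hinv _)).mpr ⟨_, w, hw, rfl⟩,
          g ^ (0 : ℤ) * ι (ρ (g ^ (-l)) u),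
          (mem_zpowers_sup_map hρ (hinv _)).mpr ⟨_, _, hinv _ _ _ hu, rfl⟩, ?_⟩
        have h1 : ι w * ι (ρ (g ^ (-l)) u) = ι (ρ (g ^ (-l)) u) * ι w := by
          rw [← map_mul, mul_comm, map_mul]
        simp only [zpow_zero, one_mul]
        rw [mul_assoc, h1, hρ, zpow_add]
        group
      exact (this m n).antisymm (this n m)
    have hirr : ∀ n, ¬ Subgroup.zpowers g ⊔ (O (φ n)).map ι ≤
        ⨆ m ∈ {m | m ≠ n}, (Subgroup.zpowers g ⊔ (O (φ m)).map ι) := by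
      intro n hn
      obtain ⟨⟨b, hb⟩, hb'⟩ := Subgroup.ne_bot_iff_exists_ne_one.mp (hO (φ n))
      have hb1 : b ≠ 1 := fun e => hb' (Subtype.ext e)
      have h1 : (⨆ m ∈ {m | m ≠ n}, (Subgroup.zpowers g ⊔ (O (φ m)).map ι)) ≤
          Subgroup.zpowers g ⊔ (⨆ m ∈ φ '' {m | m ≠ n}, O m).map ι := by
        refine iSup₂_le fun m hm => sup_le_sup_left (Subgroup.map_mono ?_) _
        exact le_biSup O (Set.mem_image_of_mem φ hm)
      obtain ⟨k, u, hu, hbu⟩ := (mem_zpowers_sup_map hρ (hinvS _)).mp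
        (h1 (hn (Subgroup.mem_sup_right ⟨b, hb, rfl⟩)))
      have h2 := hcancel k 0 u b (by rw [← hbu, zpow_zero, one_mul])
      have h3 : b ∈ ((Subgroup.zpowers g).comap ι) ⊔ ⨆ m ∈ φ '' {m | m ≠ n}, O m :=
        Subgroup.mem_sup.mpr ⟨_, h2, u, hu, by simp⟩
      have h4 : b ∈ ⨆ m ∈ ({φ n} : Set ℕ), O m := by simpa using hb
      refine hb1 ((Subgroup.disjoint_def.mp (hind (φ '' {m | m ≠ n}) {φ n} ?_)) h3 h4)
      rw [Set.disjoint_singleton_right]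
      rintro ⟨m, hm, hmn⟩
      exact hm (hφ hmn)
    obtain ⟨I, hI, hI'⟩ := hG.exists_iSup (fun n => Subgroup.zpowers g ⊔ (O (φ n)).map ι) hperm hirr
    refine ⟨I, hI.nonempty, ?_⟩
    rw [← hjoin _ (hI.nonempty.image φ), iSup_image]
    exact hI'
  -- Even and odd indices provide the two disjoint families.
  obtain ⟨I, hI, hI'⟩ := hsub (fun n => 2 * n) (fun m n h => by simpa using h)
  obtain ⟨J, hJ, hJ'⟩ := hsub (fun n => 2 * n + 1) (fun m n h => by simpa using h)
  refine hχ.zpowers g ?_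
  convert hχ.inf _ _ hI' hJ' using 1
  refine le_antisymm (le_inf le_sup_left le_sup_left) ?_
  rintro x ⟨hx, hx'⟩
  obtain ⟨k, u, hu, rfl⟩ := (mem_zpowers_sup_map hρ (hinvS _)).mp hx
  obtain ⟨l, w, hw, hkl⟩ := (mem_zpowers_sup_map hρ (hinvS _)).mp hx'
  have h1 := hcancel k l u w hkl
  have h2 : w ∈ ((Subgroup.zpowers g).comap ι) ⊔ ⨆ m ∈ (fun n => 2 * n) '' I, O m :=
    Subgroup.mem_sup.mpr ⟨_, h1, u, hu, by simp⟩
  have h3 := (Subgroup.disjoint_def.mp (hind _ _ ?_)) h2 hw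
  · rw [hkl, h3, map_one, mul_one]
    exact ⟨l, rfl⟩
  · rw [Set.disjoint_left]
    rintro _ ⟨i, -, rfl⟩ ⟨j, -, hj⟩
    simp only at hj
    omega

theorem IsTame.finite_conjugatesOf_of_forall_finset {χ : Subgroup G → Prop} (hχ : IsTame χ)
    (hG : AntichainCondition G χ) (hι : Function.Injective ι)
    (hρ : ∀ g v, ι (ρ g v) = g * ι v * g⁻¹) (g : G)
    (h : ∀ S : Finset V, ∃ T : Finset V, Subgroup.closure (T : Set V) ≠ ⊥ ∧
      (∀ (k : ℤ), ∀ v ∈ Subgroup.closure (T : Set V), ρ (g ^ k) v ∈ Subgroup.closure (T : Set V)) ∧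
      Disjoint (Subgroup.closure (T : Set V)) (Subgroup.closure (S : Set V))) :
    (conjugatesOf g).Finite := by
  classical
  set Z := (Subgroup.zpowers g).comap ι
  obtain ⟨z, hz⟩ : ∃ z : V, Subgroup.zpowers z = Z := by
    have h1 : IsCyclic (Z.map ι) :=
      Subgroup.isCyclic_of_le (Subgroup.map_comap_le ι (Subgroup.zpowers g))
    have h2 : IsCyclic Z := ((Z.equivMapOfInjective ι hι).isCyclic).mpr h1
    exact Subgroup.isCyclic_iff_exists_zpowers_eq_top Z |>.mp h2
  obtain ⟨T, hT⟩ := exists_seq_of_forall_finset (α := Finset V)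
    (fun s T => Subgroup.closure (T : Set V) ≠ ⊥ ∧
      (∀ (k : ℤ), ∀ v ∈ Subgroup.closure (T : Set V), ρ (g ^ k) v ∈ Subgroup.closure (T : Set V)) ∧
      Disjoint (Subgroup.closure (T : Set V))
        (Subgroup.closure ((insert z (s.biUnion id) : Finset V) : Set V)))
    (fun s => h (insert z (s.biUnion id)))
  let S : ℕ → Finset V := fun n => insert z (((Finset.range n).image T).biUnion id)
  have hS : Monotone S := fun m n hmn => Finset.insert_subset_insert _
    (Finset.biUnion_subset_biUnion_of_subset_left _ (Finset.image_subset_image (Finset.range_mono hmn)))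
  -- The cyclic group Z = ⟨g⟩ ∩ V takes index 0 and the chosen subgroups are shifted by one, so a
  -- single independence statement covers all of them.
  let t : ℕ → Subgroup V := fun n => Nat.casesOn n Z fun n => Subgroup.closure (T n : Set V)
  let U : ℕ → Subgroup V := fun n => Nat.casesOn n ⊥ fun n => Subgroup.closure (S n : Set V)
  have hind : iSupIndep t := by
    refine iSupIndep_of_disjoint_of_lt t U ?_ ?_ ?_
    · refine monotone_nat_of_le_succ fun n => ?_
      cases n with
      | zero => exact bot_le
      | succ n => exact Subgroup.closure_mono (hS n.le_succ)
    · intro n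
      cases n with
      | zero =>
        change Z ≤ Subgroup.closure (S 0 : Set V)
        rw [← hz, Subgroup.zpowers_le]
        exact Subgroup.subset_closure (Finset.mem_insert_self _ _)
      | succ n =>
        refine Subgroup.closure_mono ?_
        have : T n ⊆ S (n + 1) := (Finset.subset_biUnion_of_mem id (Finset.mem_image_of_mem T
          (Finset.mem_range.mpr n.lt_succ_self))).trans (Finset.subset_insert _ _)
        exact_mod_cast this
    · intro n
      cases n with
      | zero => exact disjoint_bot_right
      | succ n => exact (hT n).2.2
  refine hχ.finite_conjugatesOf_of_iSupIndep hG hρ g (fun n => Subgroup.closure (T n : Set V))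
    (fun n => (hT n).1) (fun n => (hT n).2.1) fun I J hIJ => ?_
  have h1 := hind.disjoint_biSup_biSup (s := insert 0 (Nat.succ '' I)) (t := Nat.succ '' J) (by
    rw [Set.disjoint_left]
    rintro _ (rfl | ⟨i, hi, rfl⟩) ⟨j, hj, hij⟩
    · exact absurd hij (Nat.succ_ne_zero j)
    · exact Set.disjoint_left.mp hIJ hi (Nat.succ_injective hij ▸ hj))
  rw [iSup_insert, iSup_image, iSup_image] at h1
  exact h1

end CyclicExtension


/-! ### Abelian groups and modules: torsion, finite orbits, avoiding finitely generated submodules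
-/

section AbelianGroups

theorem finite_torsion_of_fg {V : Type*} [CommGroup V] {K : Subgroup V} (hK : K.FG) :
    {x | x ∈ K ∧ IsOfFinOrder x}.Finite := by
  have h1 : Group.FG K := (Group.fg_iff_subgroup_fg K).mpr hK
  have h2 : Module.Finite ℤ (Additive K) :=
    Module.Finite.iff_addGroup_fg.mpr (AddGroup.fg_iff_mul_fg.mpr h1)
  have h3 : Module.Finite ℤ (Submodule.torsion ℤ (Additive K)) := inferInstance
  have h4 : Finite (Submodule.torsion ℤ (Additive K)) :=
    Module.finite_of_fg_torsion _ (Submodule.torsion_isTorsion)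
  refine ((Set.toFinite (Submodule.torsion ℤ (Additive K) : Set (Additive K))).image
    (fun x => ((Additive.toMul x : K) : V))).subset ?_
  rintro x ⟨hx, hx'⟩
  refine ⟨Additive.ofMul ⟨x, hx⟩, ?_, rfl⟩
  obtain ⟨n, hn, hxn⟩ := isOfFinOrder_iff_pow_eq_one.mp hx'
  rw [SetLike.mem_coe, Submodule.mem_torsion_iff]
  refine ⟨⟨(n : ℤ), by simpa using hn.ne'⟩, ?_⟩
  change (n : ℤ) • Additive.ofMul (⟨x, hx⟩ : K) = 0
  rw [← ofMul_zpow, ← ofMul_one]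
  congr 1
  exact Subtype.ext (by simpa using hxn)

theorem exists_pow_eq_one_of_fg {V : Type*} [CommGroup V] {K : Subgroup V} (hK : K.FG) :
    ∃ t : ℕ, 0 < t ∧ ∀ x ∈ K, IsOfFinOrder x → x ^ t = 1 := by
  refine ⟨∏ x ∈ (finite_torsion_of_fg hK).toFinset, orderOf x, ?_, ?_⟩
  · refine Finset.prod_pos fun x hx => ?_
    exact ((finite_torsion_of_fg hK).mem_toFinset.mp hx).2.orderOf_pos
  · intro x hx hx'
    exact orderOf_dvd_iff_pow_eq_one.mp
      (Finset.dvd_prod_of_mem _ ((finite_torsion_of_fg hK).mem_toFinset.mpr ⟨hx, hx'⟩))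

theorem zpow_apply_eq_self {V : Type*} [CommGroup V] {σ : MulAut V} {b : V} {N : ℕ}
    (hN : (σ ^ N) b = b) (k : ℤ) : (σ ^ ((N : ℤ) * k)) b = b := by
  have h1 : σ ^ N ∈ MulAction.stabilizer (MulAut V) b := hN
  have h2 := (MulAction.stabilizer (MulAut V) b).zpow_mem h1 k
  rw [← zpow_natCast, ← zpow_mul] at h2
  exact h2

theorem exists_finset_closure_invariant {V : Type*} [CommGroup V] (σ : MulAut V) {b : V} {N : ℕ}
    (hN0 : 0 < N) (hN : (σ ^ N) b = b) :
    ∃ T : Finset V, b ∈ T ∧ (∀ t ∈ T, ∃ i < N, t = (σ ^ i) b) ∧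
      ∀ (k : ℤ), ∀ v ∈ Subgroup.closure (T : Set V), (σ ^ k) v ∈ Subgroup.closure (T : Set V) := by
  classical
  refine ⟨(Finset.range N).image fun i => (σ ^ i) b, ?_, ?_, ?_⟩
  · exact Finset.mem_image.mpr ⟨0, Finset.mem_range.mpr hN0, by simp⟩
  · intro t ht
    obtain ⟨i, hi, rfl⟩ := Finset.mem_image.mp ht
    exact ⟨i, Finset.mem_range.mp hi, rfl⟩
  · intro k
    set T := (Finset.range N).image fun i => (σ ^ i) b
    have : Subgroup.closure (T : Set V) ≤ (Subgroup.closure (T : Set V)).comap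
        (σ ^ k).toMonoidHom := by
      rw [Subgroup.closure_le]
      intro t ht
      obtain ⟨i, hi, rfl⟩ := Finset.mem_image.mp (Finset.mem_coe.mp ht)
      refine Subgroup.subset_closure (Finset.mem_coe.mpr (Finset.mem_image.mpr
        ⟨((k + i) % N).toNat, Finset.mem_range.mpr ?_, ?_⟩))
      · have := Int.emod_lt_of_pos (k + i) (by exact_mod_cast hN0 : (0 : ℤ) < N)
        have := Int.emod_nonneg (k + i) (by exact_mod_cast hN0.ne' : (N : ℤ) ≠ 0)
        omega
      · have h1 := Int.emod_nonneg (k + i) (by exact_mod_cast hN0.ne' : (N : ℤ) ≠ 0)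
        change (σ ^ ((k + i) % N).toNat) b = (σ ^ k) ((σ ^ i) b)
        rw [← MulAut.mul_apply, ← zpow_natCast, ← zpow_natCast σ i, ← zpow_add,
          Int.toNat_of_nonneg h1]
        conv_rhs => rw [← Int.emod_add_mul_ediv (k + i) N, zpow_add, MulAut.mul_apply,
          zpow_apply_eq_self hN]
    exact this

/-- If a module over an integral domain has infinite rank, then finitely many endomorphisms map some
torsion-free element into a submodule meeting a given finitely generated one in torsion. -/
theorem exists_torsionFree_forall_mem {R : Type} [CommRing R] [IsDomain R]
    {M : Type*} [AddCommGroup M] [Module R M]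
    (hM : ℵ₀ ≤ Module.rank R M) (W : Submodule R M) (hW : W.FG) {N : ℕ} (σ : Fin N → M →ₗ[R] M) :
    ∃ P : Submodule R M, (∀ w ∈ W, w ∈ P → ∃ n : R, n ≠ 0 ∧ n • w = 0) ∧
      ∃ b : M, (∀ n : R, n • b = 0 → n = 0) ∧ ∀ i, σ i b ∈ P := by
  classical
  -- After localization W spans a finite-dimensional space with a complement C of finite
  -- codimension; P is the preimage of C. The requirement that every `σ i b` lie in P is the
  -- vanishing of a map of finite rank, so its kernel has nonzero rank.
  let K := FractionRing R
  let L := LocalizedModule (nonZeroDivisors R) M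
  let f : M →ₗ[R] L := LocalizedModule.mkLinearMap (nonZeroDivisors R) M
  obtain ⟨s, hs⟩ := hW
  let WK : Submodule K L := Submodule.span K (f '' s)
  have hfin : Module.Finite K WK := Module.Finite.span_of_finite K (s.finite_toSet.image f)
  obtain ⟨C, hC⟩ := Submodule.exists_isCompl WK
  have hWK : ∀ w ∈ W, f w ∈ WK := by
    intro w hw
    rw [← hs] at hw
    have : Submodule.span R (s : Set M) ≤ (WK.restrictScalars R).comap f := by
      rw [Submodule.span_le]
      intro x hx
      exact Submodule.subset_span ⟨x, hx, rfl⟩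
    exact this hw
  have hQ : Module.Finite K (L ⧸ C) :=
    Module.Finite.equiv (Submodule.quotientEquivOfIsCompl C WK hC.symm).symm
  let q : M →ₗ[R] (L ⧸ C) := (C.mkQ.restrictScalars R).comp f
  refine ⟨LinearMap.ker q, ?_, ?_⟩
  · intro w hw hwP
    have h1 : f w ∈ C := (Submodule.Quotient.mk_eq_zero C).mp hwP
    have h2 : f w = 0 := (Submodule.disjoint_def.mp hC.disjoint) _ (hWK w hw) h1
    obtain ⟨c, hc⟩ := (IsLocalizedModule.eq_zero_iff (nonZeroDivisors R) f).mp h2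
    exact ⟨c, nonZeroDivisors.ne_zero c.2, hc⟩
  · let Φ : M →ₗ[R] (Fin N → L ⧸ C) := LinearMap.pi fun i => q.comp (σ i)
    have h1 : Module.rank R (Fin N → L ⧸ C) < ℵ₀ := by
      rw [← IsLocalization.rank_eq K (nonZeroDivisors R) le_rfl]
      exact Module.rank_lt_aleph0 K _
    have h2 : Module.rank R (LinearMap.ker Φ) ≠ 0 := by
      intro h0
      have h3 := LinearMap.rank_range_add_rank_ker Φ
      rw [h0, add_zero] at h3
      exact absurd (hM.trans_eq h3.symm) (not_le.mpr ((Submodule.rank_le _).trans_lt h1))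
    rw [Ne, rank_eq_zero_iff] at h2
    push Not at h2
    obtain ⟨⟨b, hb⟩, hb'⟩ := h2
    refine ⟨b, fun n hn => ?_, fun i => congrFun hb i⟩
    by_contra hne
    exact hb' n hne (Subtype.ext hn)

/-- A complement P of the finite W has finite index, so two elements of the infinite M have the same
images under all `σ i` modulo P; their difference serves as b. -/
theorem exists_ne_zero_forall_mem {F M : Type*} [Field F] [AddCommGroup M] [Module F M]
    [Infinite M] (W : Submodule F M) [Finite W] {N : ℕ} (σ : Fin N → M →+ M) :
    ∃ P : Submodule F M, Disjoint P W ∧ ∃ b : M, b ≠ 0 ∧ ∀ i, σ i b ∈ P := by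
  obtain ⟨P, hP⟩ := Submodule.exists_isCompl W
  have hfin : Finite (M ⧸ P) :=
    Finite.of_equiv W (Submodule.quotientEquivOfIsCompl P W hP.symm).symm.toEquiv
  obtain ⟨x, y, hxy, h⟩ := Finite.exists_ne_map_eq_of_infinite
    (fun (x : M) (i : Fin N) => P.mkQ (σ i x))
  refine ⟨P, hP.disjoint.symm, x - y, sub_ne_zero.mpr hxy, fun i => ?_⟩
  rw [map_sub]
  exact (Submodule.Quotient.eq P).mp (congrFun h i)

end AbelianGroups


/-! ### Invariant finitely generated subgroups avoiding a given finite set -/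

section Greedy

variable {V : Type*} [CommGroup V] (σ : MulAut V)

/-- The orbit of c lies in P, which meets ⟨S⟩ in torsion only. Replacing c by `c ^ t`, where t kills
the torsion of the span of the orbit, makes the new span torsion-free and so disjoint from ⟨S⟩. -/
theorem exists_invariant_disjoint_of_torsionFreeRank (hV : ℵ₀ ≤ torsionFreeRank V) {N : ℕ}
    (hN0 : 0 < N) (hN : ∀ v, (σ ^ N) v = v) (S : Finset V) :
    ∃ T : Finset V, Subgroup.closure (T : Set V) ≠ ⊥ ∧
      (∀ (k : ℤ), ∀ v ∈ Subgroup.closure (T : Set V), (σ ^ k) v ∈ Subgroup.closure (T : Set V)) ∧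
      Disjoint (Subgroup.closure (T : Set V)) (Subgroup.closure (S : Set V)) := by
  let W : Submodule ℤ (Additive V) :=
    AddSubgroup.toIntSubmodule (Subgroup.toAddSubgroup (Subgroup.closure (S : Set V)))
  have hW : W.FG := by
    rw [Submodule.fg_iff_addSubgroup_fg]
    exact (Subgroup.fg_iff_add_fg _).mp ⟨S, rfl⟩
  obtain ⟨P, hWP, b, hb, hbP⟩ := exists_torsionFree_forall_mem (R := ℤ) hV W hW
    (fun i : Fin N => (MonoidHom.toAdditive (σ ^ (i : ℕ)).toMonoidHom).toIntLinearMap)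
  let c : V := Additive.toMul b
  have hc : ∀ n : ℤ, c ^ n = 1 → n = 0 := fun n hn => hb n hn
  let PV : Subgroup V := AddSubgroup.toSubgroup' P.toAddSubgroup
  have hcP : ∀ i < N, (σ ^ i) c ∈ PV := fun i hi => hbP ⟨i, hi⟩
  obtain ⟨T, hcT, -, hinvT⟩ := exists_finset_closure_invariant σ hN0 (hN c)
  obtain ⟨t, ht, htT⟩ := exists_pow_eq_one_of_fg (K := Subgroup.closure (T : Set V)) ⟨T, rfl⟩
  obtain ⟨T', hcT', hTc', hinv⟩ := exists_finset_closure_invariant σ hN0 (hN (c ^ t))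
  refine ⟨T', ?_, hinv, ?_⟩
  · intro hbot
    have h1 : c ^ t ∈ Subgroup.closure (T' : Set V) := Subgroup.subset_closure hcT'
    rw [hbot, Subgroup.mem_bot] at h1
    have := hc t (by exact_mod_cast h1)
    omega
  · rw [Subgroup.disjoint_def]
    intro x hx hxS
    have hxP : x ∈ PV := by
      have : Subgroup.closure (T' : Set V) ≤ PV := by
        rw [Subgroup.closure_le]
        intro y hy
        obtain ⟨i, hi, rfl⟩ := hTc' y hy
        rw [map_pow]
        exact PV.pow_mem (hcP i hi) t
      exact this hx
    have hxT : x ∈ (Subgroup.closure (T : Set V)).map (powMonoidHom t) := by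
      have : Subgroup.closure (T' : Set V) ≤ (Subgroup.closure (T : Set V)).map (powMonoidHom t) := by
        rw [Subgroup.closure_le]
        intro y hy
        obtain ⟨i, hi, rfl⟩ := hTc' y hy
        refine ⟨(σ ^ i) c, ?_, by simp⟩
        have h1 := hinvT i c (Subgroup.subset_closure hcT)
        rwa [zpow_natCast] at h1
      exact this hx
    obtain ⟨y, hy, rfl⟩ := hxT
    obtain ⟨n, hn, hnx⟩ := hWP _ hxS hxP
    have h2 : (y ^ t) ^ n = 1 := hnx
    have h3 : IsOfFinOrder (y ^ t) := isOfFinOrder_iff_zpow_eq_one.mpr ⟨n, hn, h2⟩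
    exact htT y hy ((isOfFinOrder_pow.mp h3).resolve_right ht.ne')

theorem exists_invariant_disjoint_of_infinite_ker_pow {p : ℕ} (hp : p.Prime)
    (hV : {v : V | v ^ p = 1}.Infinite) {N : ℕ} (hN0 : 0 < N)
    (hN : ∀ v : V, v ^ p = 1 → (σ ^ N) v = v) (S : Finset V) :
    ∃ T : Finset V, Subgroup.closure (T : Set V) ≠ ⊥ ∧
      (∀ (k : ℤ), ∀ v ∈ Subgroup.closure (T : Set V), (σ ^ k) v ∈ Subgroup.closure (T : Set V)) ∧
      Disjoint (Subgroup.closure (T : Set V)) (Subgroup.closure (S : Set V)) := by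
  have : Fact p.Prime := ⟨hp⟩
  let B : Subgroup V := (powMonoidHom p : V →* V).ker
  obtain ⟨_⟩ : Nonempty (Module (ZMod p) (Additive B)) := ⟨AddCommGroup.zmodModule fun x => by
    obtain ⟨x, hx⟩ := x
    exact Subtype.ext hx⟩
  have hB : Infinite (Additive B) := hV.to_subtype
  let W : Submodule (ZMod p) (Additive B) := AddSubgroup.toZModSubmodule p
    (Subgroup.toAddSubgroup ((Subgroup.closure (S : Set V)).subgroupOf B))
  have hfin := finite_torsion_of_fg (K := Subgroup.closure (S : Set V)) ⟨S, rfl⟩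
  have hWfin : Finite W := by
    have := hfin.to_subtype
    refine Finite.of_injective (fun w : W => (⟨((Additive.toMul w.1 : B) : V), w.2,
      isOfFinOrder_iff_pow_eq_one.mpr ⟨p, hp.pos, (Additive.toMul w.1).2⟩⟩ :
        {x | x ∈ Subgroup.closure (S : Set V) ∧ IsOfFinOrder x})) ?_
    intro a b hab
    have h := Subtype.ext_iff.mp hab
    exact Subtype.ext (Additive.toMul.injective (Subtype.ext h))
  have hσ : ∀ (i : ℕ) (x : B), (σ ^ i) (x : V) ∈ B := by
    rintro i ⟨x, hx⟩
    change ((σ ^ i) x) ^ p = 1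
    rw [← map_pow, show x ^ p = 1 from hx, map_one]
  obtain ⟨P, hPW, b, hb, hbP⟩ := exists_ne_zero_forall_mem W (fun i : Fin N =>
    MonoidHom.toAdditive (((σ ^ (i : ℕ)).toMonoidHom.comp B.subtype).codRestrict B (hσ i)))
  let c : B := Additive.toMul b
  obtain ⟨T, hcT, hTc, hinv⟩ := exists_finset_closure_invariant σ hN0 (hN c c.2)
  refine ⟨T, ?_, hinv, ?_⟩
  · intro hbot
    have h1 : (c : V) ∈ Subgroup.closure (T : Set V) := Subgroup.subset_closure hcT
    rw [hbot, Subgroup.mem_bot] at h1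
    exact hb (Subtype.ext h1)
  · rw [Subgroup.disjoint_def]
    intro x hx hxS
    let PB : Subgroup B := AddSubgroup.toSubgroup' P.toAddSubgroup
    have : Subgroup.closure (T : Set V) ≤ PB.map B.subtype := by
      rw [Subgroup.closure_le]
      intro y hy
      obtain ⟨i, hi, rfl⟩ := hTc y hy
      exact ⟨⟨(σ ^ i) c, hσ i c⟩, hbP ⟨i, hi⟩, rfl⟩
    obtain ⟨y, hy, rfl⟩ := this hx
    have h1 : Additive.ofMul y = 0 := Submodule.disjoint_def.mp hPW _ hy hxS
    have h2 : y = 1 := h1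
    rw [h2, map_one]

/-- A prime p larger than an exponent t of the torsion of ⟨S⟩ is coprime to t, so no nontrivial
element killed by p lies in ⟨S⟩. Here finiteness of single orbits is enough. -/
theorem exists_invariant_disjoint_of_infinite_primes
    (hV : {p : ℕ | p.Prime ∧ ∃ v : V, v ≠ 1 ∧ v ^ p = 1}.Infinite)
    (hloc : ∀ v, ∃ N, 0 < N ∧ (σ ^ N) v = v) (S : Finset V) :
    ∃ T : Finset V, Subgroup.closure (T : Set V) ≠ ⊥ ∧
      (∀ (k : ℤ), ∀ v ∈ Subgroup.closure (T : Set V), (σ ^ k) v ∈ Subgroup.closure (T : Set V)) ∧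
      Disjoint (Subgroup.closure (T : Set V)) (Subgroup.closure (S : Set V)) := by
  obtain ⟨t, ht, htS⟩ := exists_pow_eq_one_of_fg (K := Subgroup.closure (S : Set V)) ⟨S, rfl⟩
  obtain ⟨p, ⟨hp, v, hv, hvp⟩, hpt⟩ := hV.exists_gt t
  obtain ⟨N, hN0, hN⟩ := hloc v
  obtain ⟨T, hcT, hTc, hinv⟩ := exists_finset_closure_invariant σ hN0 hN
  refine ⟨T, ?_, hinv, ?_⟩
  · intro hbot
    have h1 : v ∈ Subgroup.closure (T : Set V) := Subgroup.subset_closure hcT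
    rw [hbot, Subgroup.mem_bot] at h1
    exact hv h1
  · rw [Subgroup.disjoint_def]
    intro x hx hxS
    have : Subgroup.closure (T : Set V) ≤ (powMonoidHom p : V →* V).ker := by
      rw [Subgroup.closure_le]
      intro y hy
      obtain ⟨i, hi, rfl⟩ := hTc y hy
      change ((σ ^ i) v) ^ p = 1
      rw [← map_pow, hvp, map_one]
    have h1 : x ^ p = 1 := this hx
    have h2 := htS x hxS (isOfFinOrder_iff_pow_eq_one.mpr ⟨p, hp.pos, h1⟩)
    have h3 : Nat.Coprime p t := hp.coprime_iff_not_dvd.mpr (Nat.not_dvd_of_pos_of_lt ht hpt)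
    have h4 := orderOf_dvd_of_pow_eq_one h1
    have h5 := orderOf_dvd_of_pow_eq_one h2
    exact orderOf_eq_one_iff.mp (Nat.eq_one_of_dvd_coprimes h3 h4 h5)

end Greedy

/-! ### A single power of the automorphism acts trivially -/

section PowerAction

/-- If `σ` fixes `E` pointwise and `σ a = e * a ^ k` with `e ∈ ⟨E⟩`, then the powers of `σ` act in
the same way. -/
theorem exists_pow_apply_eq {V : Type*} [CommGroup V] {σ : MulAut V} {K : Subgroup V}
    (hσ : ∀ e ∈ K, σ e = e) {a : V} {k : ℤ} (h : σ a * (a ^ k)⁻¹ ∈ K) (j : ℕ) :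
    (σ ^ j) a * (a ^ (k ^ j))⁻¹ ∈ K := by
  induction j with
  | zero => simp
  | succ j ih =>
    rw [pow_succ', MulAut.mul_apply]
    have h1 : σ ((σ ^ j) a * (a ^ k ^ j)⁻¹) ∈ K := by rwa [hσ _ ih]
    rw [map_mul, map_inv, map_zpow] at h1
    have h2 := K.mul_mem h1 (K.zpow_mem h (k ^ j))
    convert h2 using 1
    rw [mul_zpow, inv_zpow, ← zpow_mul, pow_succ' k j, mul_assoc, inv_mul_cancel_left]

theorem pow_apply_eq_pow_mul {V : Type*} [CommGroup V] {σ : MulAut V} {a f : V}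
    (hf : σ f = f) (h : σ a = f * a) (j : ℕ) : (σ ^ j) a = f ^ j * a := by
  induction j with
  | zero => simp
  | succ j ih => rw [pow_succ', MulAut.mul_apply, ih, map_mul, map_pow, hf, h, pow_succ, mul_assoc]

variable {V : Type*} [CommGroup V] {σ : MulAut V}
  (hloc : ∀ S : Finset V, ∃ N, 0 < N ∧ ∀ v ∈ S, (σ ^ N) v = v) {E : Finset V}
  (hE : ∀ a : V, (∀ n : ℤ, a ^ n ∈ Subgroup.closure (E : Set V) → a ^ n = 1) →
    ∀ k : ℕ, (∀ e ∈ E, (σ ^ k) e = e) →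
      (σ ^ k) a ∈ Subgroup.closure (E : Set V) ⊔ Subgroup.zpowers a)

theorem apply_eq_self_of_mem_closure {τ : MulAut V} (h : ∀ e ∈ E, τ e = e) :
    ∀ e ∈ Subgroup.closure (E : Set V), τ e = e := by
  intro e he
  have : Subgroup.closure (E : Set V) ≤ MonoidHom.eqLocus τ.toMonoidHom (MonoidHom.id V) := by
    rw [Subgroup.closure_le]
    exact fun x hx => h x hx
  exact this he

include hloc hE

/-- Let τ = σ ^ k fix E. For a outside ⟨E⟩ with a ^ p = 1, τ a = e * a ^ l with p not dividing l, as
τ is injective and fixes e. By Fermat, τ ^ (p - 1) multiplies a by some f in ⟨E⟩ with f ^ p = 1, so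
its p-th power fixes a. -/
theorem exists_pow_apply_eq_self_of_pow_eq_one {p : ℕ} (hp : p.Prime) :
    ∃ N, 0 < N ∧ ∀ v : V, v ^ p = 1 → (σ ^ N) v = v := by
  obtain ⟨k, hk, hkE⟩ := hloc E
  set τ := σ ^ k
  have hτ := apply_eq_self_of_mem_closure hkE
  refine ⟨k * ((p - 1) * p), Nat.mul_pos hk (Nat.mul_pos (Nat.sub_pos_of_lt hp.one_lt) hp.pos),
    fun a ha => ?_⟩
  rw [pow_mul, pow_mul]
  by_cases haE : a ∈ Subgroup.closure (E : Set V)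
  · have h1 : τ ∈ MulAction.stabilizer (MulAut V) a := hτ a haE
    exact Subgroup.pow_mem _ (Subgroup.pow_mem _ h1 _) _
  have hcop : ∀ n : ℤ, ¬ (p : ℤ) ∣ n → ∃ u v : ℤ, n * u + p * v = 1 := fun n hn =>
    ((Nat.prime_iff_prime_int.mp hp).coprime_iff_not_dvd.mpr hn) |> fun ⟨u, v, h⟩ =>
      ⟨v, u, by linarith⟩
  have hap : ∀ v : ℤ, a ^ ((p : ℤ) * v) = 1 := fun v => by
    rw [zpow_mul, zpow_natCast, ha, one_zpow]
  have hind : ∀ n : ℤ, a ^ n ∈ Subgroup.closure (E : Set V) → a ^ n = 1 := by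
    intro n hn
    by_cases hpn : (p : ℤ) ∣ n
    · obtain ⟨v, rfl⟩ := hpn
      exact hap v
    · obtain ⟨u, v, huv⟩ := hcop n hpn
      refine absurd ?_ haE
      have h1 : a = (a ^ n) ^ u := by
        conv_lhs => rw [← zpow_one a, ← huv, zpow_add, hap, mul_one, zpow_mul]
      rw [h1]
      exact Subgroup.zpow_mem _ hn u
  obtain ⟨e, he, _, ⟨l, rfl⟩, hel⟩ := Subgroup.mem_sup.mp (hE a hind k hkE)
  simp only at hel
  have hpl : ¬ (p : ℤ) ∣ l := by
    rintro ⟨v, rfl⟩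
    rw [hap, mul_one] at hel
    have h1 : τ a = τ e := by rw [hτ e he, hel]
    exact haE (τ.injective h1 ▸ he)
  have h1 : τ a * (a ^ l)⁻¹ ∈ Subgroup.closure (E : Set V) := by
    rw [← hel]; simpa using he
  have h2 := exists_pow_apply_eq hτ h1 (p - 1)
  have h3 : a ^ (l ^ (p - 1)) = a := by
    have h4 : l ^ (p - 1) ≡ 1 [ZMOD p] := Int.ModEq.pow_card_sub_one_eq_one hp
      (Int.isCoprime_iff_gcd_eq_one.mpr (by
        obtain ⟨u, v, huv⟩ := hcop l hpl
        exact Int.isCoprime_iff_gcd_eq_one.mp ⟨u, v, by linarith⟩))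
    obtain ⟨v, hv⟩ := h4.symm.dvd
    have h5 : l ^ (p - 1) = 1 + p * v := by linarith
    rw [h5, zpow_add, zpow_one, hap, mul_one]
  rw [h3] at h2
  set f := (τ ^ (p - 1)) a * a⁻¹
  have hf : (τ ^ (p - 1)) f = f := by
    have h4 : τ ∈ MulAction.stabilizer (MulAut V) f := hτ f h2
    exact Subgroup.pow_mem _ h4 _
  have hfa : (τ ^ (p - 1)) a = f * a := by simp [f]
  have hfp : f ^ p = 1 := by
    rw [mul_pow, inv_pow, ← map_pow, ha, map_one, inv_one, mul_one]
  rw [pow_apply_eq_pow_mul hf hfa, hfp, one_mul]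

/-- If no nontrivial power of a lies in ⟨E⟩, then τ a = e * a ^ l; the orbit of a is finite, so l =
±1 and τ ^ 2 multiplies a by a torsion element of ⟨E⟩, which a uniform t kills. Infinite rank
provides such an a. Any other x has a nontrivial power in ⟨E⟩, so a * x is again of the first kind,
and x is fixed because a and a * x are. -/
theorem exists_pow_apply_eq_self_of_torsionFreeRank (hV : ℵ₀ ≤ torsionFreeRank V) :
    ∃ N, 0 < N ∧ ∀ v : V, (σ ^ N) v = v := by
  obtain ⟨k, hk, hkE⟩ := hloc E
  set τ := σ ^ k
  set K := Subgroup.closure (E : Set V)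
  have hτ := apply_eq_self_of_mem_closure hkE
  obtain ⟨t, ht, htE⟩ := exists_pow_eq_one_of_fg (K := K) ⟨E, rfl⟩
  have key : ∀ a : V, (∀ n : ℤ, a ^ n ∈ K → n = 0) → ((τ ^ 2) ^ t) a = a := by
    intro a ha
    obtain ⟨e, he, _, ⟨l, rfl⟩, hel⟩ := Subgroup.mem_sup.mp
      (hE a (fun n hn => by rw [ha n hn, zpow_zero]) k hkE)
    simp only at hel
    have h1 : τ a * (a ^ l)⁻¹ ∈ K := by
      rw [← hel]; simpa using he
    obtain ⟨s, hs, hsa⟩ := hloc {a}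
    have hsa' : (τ ^ s) a = a := by
      have h2 : σ ^ s ∈ MulAction.stabilizer (MulAut V) a := hsa a (Finset.mem_singleton_self a)
      have h3 := Subgroup.pow_mem _ h2 k
      rw [← pow_mul, mul_comm, pow_mul] at h3
      exact h3
    have hl : l ^ s = 1 := by
      have h2 := exists_pow_apply_eq hτ h1 s
      rw [hsa', ← zpow_neg, ← zpow_one_add] at h2
      have := ha _ h2
      linarith
    have hl2 : l ^ 2 = 1 := by
      have h2 : IsUnit l := IsUnit.of_pow_eq_one hl hs.ne'
      rcases Int.isUnit_iff.mp h2 with rfl | rfl <;> norm_num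
    have h2 := exists_pow_apply_eq hτ h1 2
    rw [hl2, zpow_one] at h2
    set f := (τ ^ 2) a * a⁻¹
    have hf : (τ ^ 2) f = f := by
      have h4 : τ ∈ MulAction.stabilizer (MulAut V) f := hτ f h2
      exact Subgroup.pow_mem _ h4 _
    have hfa : (τ ^ 2) a = f * a := by simp [f]
    have hfs : f ^ s = 1 := by
      have h5 := pow_apply_eq_pow_mul hf hfa s
      rw [← pow_mul, mul_comm, pow_mul] at h5
      have h6 : τ ^ s ∈ MulAction.stabilizer (MulAut V) a := hsa'
      have h7 : ((τ ^ s) ^ 2) a = a := Subgroup.pow_mem _ h6 2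
      rw [h7] at h5
      exact (mul_eq_right.mp h5.symm)
    rw [pow_apply_eq_pow_mul hf hfa,
      htE f h2 (isOfFinOrder_iff_pow_eq_one.mpr ⟨s, hs, hfs⟩), one_mul]
  obtain ⟨a, ha⟩ : ∃ a : V, ∀ n : ℤ, a ^ n ∈ K → n = 0 := by
    by_contra! hcon
    let W : Submodule ℤ (Additive V) := AddSubgroup.toIntSubmodule (Subgroup.toAddSubgroup K)
    have hW : W.FG := by
      rw [Submodule.fg_iff_addSubgroup_fg]
      exact (Subgroup.fg_iff_add_fg _).mp ⟨E, rfl⟩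
    have h1 : Module.rank ℤ (Additive V ⧸ W) = 0 := by
      rw [rank_eq_zero_iff]
      intro x
      obtain ⟨x, rfl⟩ := W.mkQ_surjective x
      obtain ⟨n, hn, hn0⟩ := hcon (Additive.toMul x)
      refine ⟨n, hn0, ?_⟩
      rw [← map_smul]
      exact (Submodule.Quotient.mk_eq_zero W).mpr hn
    have h2 := rank_quotient_add_rank_of_isDomain W
    rw [h1, zero_add] at h2
    have : Module.Finite ℤ W := Module.Finite.iff_fg.mpr hW
    exact absurd (hV.trans_eq h2.symm) (not_le.mpr (Module.rank_lt_aleph0 ℤ W))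
  refine ⟨k * (2 * t), Nat.mul_pos hk (Nat.mul_pos two_pos ht), fun x => ?_⟩
  rw [pow_mul, pow_mul]
  by_cases hx : ∀ n : ℤ, x ^ n ∈ K → n = 0
  · exact key x hx
  · push Not at hx
    obtain ⟨r, hr, hr0⟩ := hx
    have hax : ∀ n : ℤ, (a * x) ^ n ∈ K → n = 0 := by
      intro n hn
      have h1 : a ^ (n * r) ∈ K := by
        have h2 := K.mul_mem (K.zpow_mem hn r) (K.inv_mem (K.zpow_mem hr n))
        convert h2 using 1
        rw [← zpow_mul, ← zpow_mul, mul_zpow, mul_comm r n, mul_inv_cancel_right]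
      exact (mul_eq_zero.mp (ha _ h1)).resolve_right hr0
    have h1 := key _ hax
    rw [map_mul, key a ha] at h1
    exact mul_left_cancel h1

end PowerAction


/-! ### The sources of infinite total rank -/

section Rank

theorem rank_zmod_lt_aleph0 (p : ℕ) [Fact p.Prime] (M : Type*) [AddCommGroup M] [Module (ZMod p) M]
    [Finite M] : Module.rank (ZMod p) M < ℵ₀ :=
  Module.rank_lt_aleph0 (ZMod p) M

theorem sum_lt_aleph0_of_finite_support {ι : Type*} (f : ι → Cardinal) (hf : ∀ i, f i < ℵ₀)
    (hs : {i | f i ≠ 0}.Finite) : Cardinal.sum f < ℵ₀ := by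
  have h1 : Cardinal.sum f = #(Σ i, (f i).out) := by simp [Cardinal.mk_sigma]
  have h2 : ∀ i, Finite (f i).out := fun i => by
    rw [← Cardinal.lt_aleph0_iff_finite, Cardinal.mk_out]
    exact hf i
  have h3 : Finite {i | f i ≠ 0} := hs
  rw [h1, Cardinal.lt_aleph0_iff_finite]
  refine Finite.of_injective (β := Σ i : {i | f i ≠ 0}, (f i).out)
    (fun x => ⟨⟨x.1, fun h => ?_⟩, x.2⟩) ?_
  · exact (Cardinal.mk_eq_zero_iff.mp ((Cardinal.mk_out (f x.1)).trans h)).elim x.2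
  · rintro ⟨i, x⟩ ⟨j, y⟩ h
    simp only [Sigma.mk.injEq, Subtype.mk.injEq] at h
    obtain ⟨rfl, h⟩ := h
    simpa using h

theorem infinite_of_aleph0_le_totalRank {V : Type*} [CommGroup V] (h : ℵ₀ ≤ totalRank V) :
    ℵ₀ ≤ torsionFreeRank V ∨ (∃ p : ℕ, p.Prime ∧ {v : V | v ^ p = 1}.Infinite) ∨
      {p : ℕ | p.Prime ∧ ∃ v : V, v ≠ 1 ∧ v ^ p = 1}.Infinite := by
  by_contra! hcon
  obtain ⟨h1, h2, h3⟩ := hcon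
  refine absurd h (not_le.mpr (Cardinal.add_lt_aleph0 h1
    (sum_lt_aleph0_of_finite_support _ (fun p => ?_) ?_)))
  · have : Fact (p : ℕ).Prime := ⟨p.2⟩
    have hfin : {v : V | v ^ (p : ℕ) = 1}.Finite := h2 p p.2
    have : Finite (AddSubgroup.torsionBy (Additive V) ((p : ℕ) : ℤ)) := by
      have := hfin.to_subtype
      refine Finite.of_injective (fun x => (⟨Additive.toMul x.1, ?_⟩ : {v : V | v ^ (p : ℕ) = 1})) ?_
      · exact AddSubgroup.torsionBy.nsmul_iff.mp x.2
      · intro a b hab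
        have h := Subtype.ext_iff.mp hab
        exact Subtype.ext (Additive.toMul.injective h)
    exact @rank_zmod_lt_aleph0 p _ _ _ AddSubgroup.torsionBy.zmodModule _
  · refine (h3.preimage (Subtype.val_injective.injOn)).subset ?_
    intro p hp
    refine ⟨p.2, ?_⟩
    by_contra! hcon
    refine hp ?_
    have : Subsingleton (AddSubgroup.torsionBy (Additive V) ((p : ℕ) : ℤ)) := by
      have h4 : ∀ a : AddSubgroup.torsionBy (Additive V) ((p : ℕ) : ℤ), a = 0 := fun a => by
        by_contra hne
        exact hcon (Additive.toMul a.1) (fun e => hne (Subtype.ext e))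
          (AddSubgroup.torsionBy.nsmul_iff.mp a.2)
      exact ⟨fun a b => (h4 a).trans (h4 b).symm⟩
    have : Fact (p : ℕ).Prime := ⟨p.2⟩
    exact @rank_subsingleton' (ZMod p) _ _ _ AddSubgroup.torsionBy.zmodModule _ _

end Rank

/-! ### Every element has finitely many conjugates -/

section FCGroup

variable {G : Type*} [Group G]

theorem exists_mulAut_conj {V : Type*} [CommGroup V] {ι : V →* G} (hι : Function.Injective ι)
    [hn : ι.range.Normal] : ∃ ρ : G →* MulAut V, ∀ g v, ι (ρ g v) = g * ι v * g⁻¹ := by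
  let e : V ≃* ι.range := MonoidHom.ofInjective hι
  refine ⟨(MulAut.congr e.symm).toMonoidHom.comp MulAut.conjNormal, fun g v => ?_⟩
  have h1 : ∀ x : ι.range, ι (e.symm x) = x := fun x => by
    conv_rhs => rw [← e.apply_symm_apply x]
    rfl
  change ι (e.symm (MulAut.conjNormal g (e v))) = _
  rw [h1, MulAut.conjNormal_apply]
  rfl

theorem IsTame.finite_conjugatesOf {χ : Subgroup G → Prop} (hχ : IsTame χ)
    (hG : AntichainCondition G χ) (hrank : ℵ₀ ≤ totalRank (Subgroup.center (fcCenter G))) (g : G) :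
    (conjugatesOf g).Finite := by
  classical
  let V := Subgroup.center (fcCenter G)
  let ι : V →* G := (fcCenter G).subtype.comp V.subtype
  have hι : Function.Injective ι := fun a b hab => Subtype.ext (Subtype.ext hab)
  have hfc : ∀ v : V, (conjugatesOf (ι v)).Finite := fun v => v.1.2
  have hconj : ∀ g x : G, (conjugatesOf x).Finite → (conjugatesOf (g * x * g⁻¹)).Finite := by
    intro g x hx
    rwa [← (isConj_iff_conjugatesOf_eq.mp (isConj_iff.mpr ⟨g, rfl⟩) :
      conjugatesOf x = conjugatesOf (g * x * g⁻¹))]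
  have hn : ι.range.Normal := by
    refine ⟨?_⟩
    rintro _ ⟨v, rfl⟩ g
    refine ⟨⟨⟨g * ι v * g⁻¹, hconj g _ (hfc v)⟩, Subgroup.mem_center_iff.mpr ?_⟩, rfl⟩
    rintro ⟨y, hy⟩
    refine Subtype.ext ?_
    change y * (g * ι v * g⁻¹) = g * ι v * g⁻¹ * y
    have h1 := Subgroup.mem_center_iff.mp v.2 ⟨g⁻¹ * y * g⁻¹⁻¹, hconj g⁻¹ y hy⟩
    have h2 : g⁻¹ * y * g⁻¹⁻¹ * ι v = ι v * (g⁻¹ * y * g⁻¹⁻¹) := congrArg Subtype.val h1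
    calc y * (g * ι v * g⁻¹) = g * (g⁻¹ * y * g⁻¹⁻¹ * ι v) * g⁻¹ := by group
      _ = _ := by rw [h2]; group
  obtain ⟨ρ, hρ⟩ := exists_mulAut_conj hι
  obtain ⟨E, hE⟩ := hχ.exists_finset_forall_mem_sup hG hι hρ
  have hloc : ∀ S : Finset V, ∃ N, 0 < N ∧ ∀ v ∈ S, ((ρ g) ^ N) v = v := by
    intro S
    have hfi := finiteIndex_centralizer_of_finite (s := ι '' S) (S.finite_toSet.image ι) (by
      rintro _ ⟨v, -, rfl⟩
      exact hfc v)
    obtain ⟨N, hN0, -, hN⟩ := Subgroup.exists_pow_mem_of_index_ne_zero hfi.index_ne_zero g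
    refine ⟨N, hN0, fun v hv => hι ?_⟩
    rw [← map_pow, hρ, ← (Subgroup.mem_centralizer_iff.mp hN) (ι v) ⟨v, hv, rfl⟩,
      mul_inv_cancel_right]
  have hE' : ∀ a : V, (∀ n : ℤ, a ^ n ∈ Subgroup.closure (E : Set V) → a ^ n = 1) →
      ∀ k : ℕ, (∀ e ∈ E, ((ρ g) ^ k) e = e) →
        ((ρ g) ^ k) a ∈ Subgroup.closure (E : Set V) ⊔ Subgroup.zpowers a := by
    intro a ha k hk
    rw [← map_pow] at hk ⊢
    exact hE a ha _ hk
  refine hχ.finite_conjugatesOf_of_forall_finset hG hι hρ g ?_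
  simp only [map_zpow]
  rcases infinite_of_aleph0_le_totalRank hrank with h | ⟨p, hp, h⟩ | h
  · obtain ⟨N, hN0, hN⟩ := exists_pow_apply_eq_self_of_torsionFreeRank hloc hE' h
    exact exists_invariant_disjoint_of_torsionFreeRank _ h hN0 hN
  · obtain ⟨N, hN0, hN⟩ := exists_pow_apply_eq_self_of_pow_eq_one hloc hE' hp
    exact exists_invariant_disjoint_of_infinite_ker_pow _ hp h hN0 hN
  · refine exists_invariant_disjoint_of_infinite_primes _ h fun v => ?_
    obtain ⟨N, hN0, hN⟩ := hloc {v}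
    exact ⟨N, hN0, hN v (Finset.mem_singleton_self v)⟩

end FCGroup


/-! ### Commuting pairs in a group with finite conjugacy classes -/

section FCGroup

variable {G : Type*} [Group G]

theorem finite_commutators_right {g : G} (hg : (conjugatesOf g).Finite) :
    {z | ∃ x : G, ⁅x, g⁆ = z}.Finite := by
  refine (hg.image fun y => y * g⁻¹).subset ?_
  rintro _ ⟨x, rfl⟩
  exact ⟨x * g * x⁻¹, isConj_iff.mpr ⟨x, rfl⟩, by rw [commutatorElement_def]⟩

/-- Write x = r c and y = s d with r, s coset representatives and c, d in C. Then `⁅x, y⁆` is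
expressed through `⁅c, s⁆`, `⁅c, d⁆` and `⁅y, r⁆`, each from a finite set. A group with finitely
many commutators has finite derived subgroup. -/
theorem finite_commutator_of_finiteIndex (hFC : ∀ g : G, (conjugatesOf g).Finite) (C : Subgroup G)
    [C.FiniteIndex] (hC : {z | ∃ x ∈ C, ∃ y ∈ C, ⁅x, y⁆ = z}.Finite) : Finite (commutator G) := by
  have hR : (Set.range fun q : G ⧸ C => q.out).Finite := Set.finite_range _
  have hU := hR.biUnion fun r _ => finite_commutators_right (hFC r)
  have hD := hR.biUnion fun r _ => hR.biUnion fun s _ => (hU.prod (hC.prod hU)).image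
    fun p => r * (p.1 * (s * p.2.1 * s⁻¹)) * r⁻¹ * p.2.2⁻¹
  have : Finite (commutatorSet G) := by
    refine hD.subset ?_
    rintro _ ⟨x, y, rfl⟩
    have key : ∀ x : G, (x : G ⧸ C).out⁻¹ * x ∈ C := fun x =>
      QuotientGroup.eq.mp (QuotientGroup.out_eq' _)
    simp only [Set.mem_iUnion, Set.mem_range, exists_prop, Set.mem_image, Prod.exists, Set.mem_prod]
    refine ⟨_, ⟨x, rfl⟩, _, ⟨y, rfl⟩, ⁅(x : G ⧸ C).out⁻¹ * x, (y : G ⧸ C).out⁆,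
      ⁅(x : G ⧸ C).out⁻¹ * x, (y : G ⧸ C).out⁻¹ * y⁆, ⁅y, (x : G ⧸ C).out⁆,
      ⟨⟨_, ⟨y, rfl⟩, _, rfl⟩, ⟨_, key x, _, key y, rfl⟩, ⟨_, ⟨x, rfl⟩, _, rfl⟩⟩, ?_⟩
    simp only [commutatorElement_def]
    group
  infer_instance

theorem finiteIndex_center_of_finiteIndex (hFC : ∀ g : G, (conjugatesOf g).Finite)
    (C : Subgroup G) [C.FiniteIndex] (hC : ∀ x ∈ C, ∀ y ∈ C, Commute x y) :
    (Subgroup.center G).FiniteIndex := by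
  have hR : (Set.range fun q : G ⧸ C => q.out).Finite := Set.finite_range _
  have h1 := finiteIndex_centralizer_of_finite hR fun g _ => hFC g
  refine Subgroup.finiteIndex_of_le (H := C ⊓ Subgroup.centralizer (Set.range fun q : G ⧸ C => q.out)) ?_
  rintro z ⟨hz, hz'⟩
  rw [Subgroup.mem_center_iff]
  intro g
  have h2 : (g : G ⧸ C).out⁻¹ * g ∈ C := QuotientGroup.eq.mp (QuotientGroup.out_eq' _)
  have h3 : Commute (g : G ⧸ C).out z := Subgroup.mem_centralizer_iff.mp hz' _ ⟨_, rfl⟩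
  have h4 := h3.mul_left (hC _ h2 _ hz)
  rw [mul_inv_cancel_left] at h4
  exact h4.eq

/-- Pairs of elements `x n`, `y n`, such that the pairs commute with each other while the elements
of each pair do not. -/
structure CommutingPairs (x y : ℕ → G) : Prop where
  xx : ∀ m n, Commute (x m) (x n)
  yy : ∀ m n, Commute (y m) (y n)
  xy : ∀ m n, m ≠ n → Commute (x m) (y n)
  ne : ∀ n, ⁅x n, y n⁆ ≠ 1

/-- Each new pair is sought in the centralizer of all earlier ones, which has finite index because
conjugacy classes are finite. -/
theorem exists_commutingPairs [DecidableEq G] (hFC : ∀ g : G, (conjugatesOf g).Finite)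
    (C₀ : Subgroup G) [C₀.FiniteIndex] (R : Finset G → G → Prop)
    (h : ∀ (C : Subgroup G) [C.FiniteIndex] (s : Finset G),
      ∃ x ∈ C, ∃ y ∈ C, ⁅x, y⁆ ≠ 1 ∧ R s ⁅x, y⁆) :
    ∃ x y : ℕ → G, CommutingPairs x y ∧ (∀ n, x n ∈ C₀) ∧ (∀ n, y n ∈ C₀) ∧
      ∀ n, R ((Finset.range n).image fun m => ⁅x m, y m⁆) ⁅x n, y n⁆ := by
  obtain ⟨f, hf⟩ := exists_seq_of_forall_finset (α := G × G)
    (fun s p => p.1 ∈ C₀ ∧ p.2 ∈ C₀ ∧ (∀ e ∈ s, Commute e.1 p.1 ∧ Commute e.1 p.2 ∧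
      Commute e.2 p.1 ∧ Commute e.2 p.2) ∧ ⁅p.1, p.2⁆ ≠ 1 ∧
      R (s.image fun e => ⁅e.1, e.2⁆) ⁅p.1, p.2⁆) (fun s => by
        have h1 := finiteIndex_centralizer_of_finite (s.image Prod.fst ∪ s.image Prod.snd).finite_toSet
          fun g _ => hFC g
        obtain ⟨x, hx, y, hy, hxy, hR⟩ := h (C₀ ⊓ Subgroup.centralizer
          ((s.image Prod.fst ∪ s.image Prod.snd : Finset G) : Set G)) (s.image fun e => ⁅e.1, e.2⁆)
        have h2 : ∀ z ∈ Subgroup.centralizer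
          ((s.image Prod.fst ∪ s.image Prod.snd : Finset G) : Set G), ∀ e ∈ s,
            Commute e.1 z ∧ Commute e.2 z := fun z hz e he =>
          ⟨Subgroup.mem_centralizer_iff.mp hz _ (Finset.mem_coe.mpr
              (Finset.mem_union_left _ (Finset.mem_image_of_mem Prod.fst he))),
            Subgroup.mem_centralizer_iff.mp hz _ (Finset.mem_coe.mpr
              (Finset.mem_union_right _ (Finset.mem_image_of_mem Prod.snd he)))⟩
        exact ⟨(x, y), hx.1, hy.1, fun e he => ⟨(h2 x hx.2 e he).1, (h2 y hy.2 e he).1,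
          (h2 x hx.2 e he).2, (h2 y hy.2 e he).2⟩, hxy, hR⟩)
  have hlt : ∀ m n, m < n → Commute (f m).1 (f n).1 ∧ Commute (f m).1 (f n).2 ∧
      Commute (f m).2 (f n).1 ∧ Commute (f m).2 (f n).2 := fun m n hmn =>
    (hf n).2.2.1 _ (Finset.mem_image_of_mem f (Finset.mem_range.mpr hmn))
  refine ⟨fun n => (f n).1, fun n => (f n).2, ⟨fun m n => ?_, fun m n => ?_, fun m n hmn => ?_,
    fun n => (hf n).2.2.2.1⟩, fun n => (hf n).1, fun n => (hf n).2.1, fun n => ?_⟩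
  · rcases lt_trichotomy m n with h | rfl | h
    exacts [(hlt m n h).1, Commute.refl _, (hlt n m h).1.symm]
  · rcases lt_trichotomy m n with h | rfl | h
    exacts [(hlt m n h).2.2.2, Commute.refl _, (hlt n m h).2.2.2.symm]
  · rcases lt_or_gt_of_ne hmn with h | h
    exacts [(hlt m n h).2.1, (hlt n m h).2.2.1.symm]
  · have := (hf n).2.2.2.2
    rwa [Finset.image_image] at this

theorem commutatorElement_zpow_left {a b : G} (h : Commute ⁅a, b⁆ a) (i : ℤ) :
    ⁅a ^ i, b⁆ = ⁅a, b⁆ ^ i := by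
  have h1 : b * a * b⁻¹ = ⁅a, b⁆⁻¹ * a := by rw [commutatorElement_def]; group
  have h2 : b * a ^ i * b⁻¹ = ⁅a, b⁆⁻¹ ^ i * a ^ i := by
    rw [← conj_zpow, h1, h.inv_left.mul_zpow]
  calc ⁅a ^ i, b⁆ = a ^ i * (b * a ^ i * b⁻¹)⁻¹ := by rw [commutatorElement_def]; group
    _ = _ := by rw [h2, mul_inv_rev, mul_inv_cancel_left, inv_zpow, inv_inv]

namespace CommutingPairs

variable {x y : ℕ → G}

theorem swap (h : CommutingPairs x y) : CommutingPairs y x where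
  xx := h.yy
  yy := h.xx
  xy m n hmn := (h.xy n m hmn.symm).symm
  ne n hn := h.ne n (by rw [← commutatorElement_inv, hn, inv_one])

theorem comp (h : CommutingPairs x y) {f : ℕ → ℕ} (hf : Function.Injective f) :
    CommutingPairs (x ∘ f) (y ∘ f) where
  xx _ _ := h.xx _ _
  yy _ _ := h.yy _ _
  xy _ _ hmn := h.xy _ _ (hf.ne hmn)
  ne _ := h.ne _

theorem notMem_closure (h : CommutingPairs x y) (n : ℕ) :
    x n ∉ Subgroup.closure (x '' {m | m ≠ n}) :=
  notMem_closure_of_not_commute (y := y n)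
    (fun hc => h.ne n (commutatorElement_eq_one_iff_commute.mpr hc)) fun m hm => h.xy m n hm

theorem commute_commutator_x (h : CommutingPairs x y) {m n : ℕ} (hmn : m ≠ n) :
    Commute ⁅x m, y m⁆ (x n) := by
  have h1 := h.xx m n
  have h2 := h.swap.xy m n hmn
  rw [commutatorElement_def]
  exact ((h1.mul_left h2).mul_left h1.inv_left).mul_left h2.inv_left

/-- A quotient of the n-th and m-th commutators lies in the abelian group generated by the x's, so
it commutes with `x n`. The m-th commutator commutes with `x n` for m ≠ n, hence so does the n-th.
-/
theorem exists_commute_commutator (h : CommutingPairs x y) {χ : Subgroup G → Prop}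
    (hχ : IsTame χ) (hG : AntichainCondition G χ) : ∃ f : ℕ → ℕ, Function.Injective f ∧
      ∀ n, Commute ⁅x (f n), y (f n)⁆ (x (f n)) := by
  obtain ⟨J, hJ, hJ'⟩ := hχ.exists_commutator_mem hG x y h.xx h.notMem_closure
    fun n m hnm => h.xy n m hnm.ne
  refine ⟨Nat.nth (· ∈ J), Nat.nth_injective hJ, fun n => ?_⟩
  have hnJ : Nat.nth (· ∈ J) n ∈ J := Nat.nth_mem_of_infinite hJ n
  obtain ⟨m, hm, hnm⟩ := hJ.exists_gt (Nat.nth (· ∈ J) n)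
  generalize Nat.nth (· ∈ J) n = n at hnJ hnm
  have h1 := hJ' n hnJ m hm
  have h2 : Subgroup.closure (Set.range x) ≤ Subgroup.centralizer {x n} := by
    rw [Subgroup.closure_le]
    rintro _ ⟨k, rfl⟩
    exact Subgroup.mem_centralizer_singleton_iff.mpr (h.xx k n)
  have h3 : Commute (⁅x n, y n⁆⁻¹ * ⁅x m, y m⁆) (x n) :=
    Subgroup.mem_centralizer_singleton_iff.mp (h2 h1)
  have h4 := (h.commute_commutator_x hnm.ne').mul_left h3.inv_left
  rwa [mul_inv_rev, inv_inv, mul_inv_cancel_left] at h4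

end CommutingPairs

end FCGroup


/-! ### Characters of abelian groups with values in ℚ/ℤ -/

section Characters

variable {V : Type*} [CommGroup V]

/-- Characters of an abelian group with values in `ℚ / ℤ`, written multiplicatively. -/
abbrev RatChar (V : Type*) [CommGroup V] := V →* Multiplicative (AddCircle (1 : ℚ))

theorem RatChar.exists_of_notMem {N : Subgroup V} {v : V} (hv : v ∉ N) :
    ∃ θ : RatChar V, (∀ w ∈ N, θ w = 1) ∧ θ v ≠ 1 := by
  have h1 : Additive.ofMul (v : V ⧸ N) ≠ 0 := fun h => hv ((QuotientGroup.eq_one_iff v).mp h)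
  obtain ⟨c, hc⟩ := CharacterModule.exists_character_apply_ne_zero_of_ne_zero h1
  let c' : Additive (V ⧸ N) →+ AddCircle (1 : ℚ) := c
  refine ⟨(AddMonoidHom.toMultiplicativeRight c').comp (QuotientGroup.mk' N), fun w hw => ?_, ?_⟩
  · have h2 : (QuotientGroup.mk' N) w = 1 := (QuotientGroup.eq_one_iff w).mpr hw
    rw [MonoidHom.comp_apply, h2, map_one]
  · exact hc

/-- If ψ fails on c, it is corrected by a character θ trivial on E and on `c ^ q` but not on c. If
ψθ kills `c ^ i` and ψ kills `c ^ j` with q ∤ j, then θ kills `c ^ (i * j)`, so q ∤ i would give θ c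
= 1. -/
theorem RatChar.exists_extension (ψ : RatChar V) (E : Subgroup V) (c : V) {q : ℕ} (hq : q.Prime)
    (hc : ∀ i : ℤ, c ^ i ∈ E → (q : ℤ) ∣ i) :
    ∃ ψ' : RatChar V, (∀ e ∈ E, ψ' e = ψ e) ∧ ∀ i : ℤ, ψ' (c ^ i) = 1 → (q : ℤ) ∣ i := by
  by_cases hψ : ∀ i : ℤ, ψ (c ^ i) = 1 → (q : ℤ) ∣ i
  · exact ⟨ψ, fun e _ => rfl, hψ⟩
  push Not at hψ
  obtain ⟨j, hj, hqj⟩ := hψ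
  have hqp : Prime (q : ℤ) := Nat.prime_iff_prime_int.mp hq
  have h1 : c ∉ E ⊔ Subgroup.zpowers (c ^ (q : ℤ)) := by
    intro h
    obtain ⟨e, he, _, ⟨k, rfl⟩, hek⟩ := Subgroup.mem_sup.mp h
    have h2 : c ^ (1 - (q : ℤ) * k) = e := by
      rw [zpow_sub, zpow_one, zpow_mul]
      exact mul_inv_eq_of_eq_mul hek.symm
    have h3 := hc _ (h2 ▸ he)
    have h4 : (q : ℤ) ∣ 1 := (dvd_sub_left (dvd_mul_right _ _)).mp h3
    exact hqp.not_dvd_one h4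
  obtain ⟨θ, hθ, hθc⟩ := RatChar.exists_of_notMem h1
  refine ⟨ψ * θ, fun e he => ?_, fun i hi => ?_⟩
  · rw [MonoidHom.mul_apply, hθ e (Subgroup.mem_sup_left he), mul_one]
  · by_contra hqi
    have hij : ¬ (q : ℤ) ∣ i * j := fun h => (hqp.dvd_or_dvd h).elim hqi hqj
    have h2 : θ (c ^ (i * j)) = 1 := by
      have h3 : (ψ * θ) ((c ^ i) ^ j) = 1 := by rw [map_zpow, hi, one_zpow]
      have h4 : ψ ((c ^ i) ^ j) = 1 := by rw [← zpow_mul, mul_comm, zpow_mul, map_zpow, hj, one_zpow]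
      rwa [MonoidHom.mul_apply, h4, one_mul, ← zpow_mul] at h3
    have h3 : θ (c ^ (q : ℤ)) = 1 := hθ _ (Subgroup.mem_sup_right (Subgroup.mem_zpowers _))
    obtain ⟨a, b, hab⟩ := (hqp.coprime_iff_not_dvd).mpr hij
    apply hθc
    calc θ c = θ (c ^ (a * (q : ℤ) + b * (i * j))) := by rw [hab, zpow_one]
      _ = 1 := by rw [zpow_add, mul_comm a, mul_comm b, zpow_mul, zpow_mul, map_mul, map_zpow,
            map_zpow θ (c ^ (i * j)), h2, h3, one_zpow, one_zpow, one_mul]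

/-- Finitely many characters can be annihilated simultaneously by a product of powers of more than
that many elements, not all exponents being divisible by a given prime. -/
theorem exists_prod_zpow_forall_eq_one {ι : Type*} [Fintype ι] {q : ℕ} (hq : q.Prime)
    (Ψ : Finset (RatChar V)) (u : ι → V) (hcard : Ψ.card < Fintype.card ι) :
    ∃ i : ι → ℤ, (∃ n, ¬ (q : ℤ) ∣ i n) ∧ ∀ ψ ∈ Ψ, ψ (∏ n, u n ^ i n) = 1 := by
  have hr : ∀ (ψ : RatChar V) (n : ι), ∃ r : ℚ,
      Multiplicative.ofAdd (r : AddCircle (1 : ℚ)) = ψ (u n) := fun ψ n => by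
    obtain ⟨r, hr⟩ := QuotientAddGroup.mk_surjective (Multiplicative.toAdd (ψ (u n)))
    exact ⟨r, congrArg Multiplicative.ofAdd hr⟩
  choose r hr using hr
  let f : (ι → ℚ) →ₗ[ℚ] (Ψ → ℚ) := Matrix.mulVecLin (Matrix.of fun ψ n => r ψ.1 n)
  have hf : LinearMap.ker f ≠ ⊥ := by
    apply LinearMap.ker_ne_bot_of_finrank_lt
    simpa using hcard
  obtain ⟨v, hv, hv0⟩ := (Submodule.ne_bot_iff _).mp hf
  have hv' : ∀ ψ ∈ Ψ, ∑ n, r ψ n * v n = 0 := fun ψ hψ =>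
    congrFun (LinearMap.mem_ker.mp hv) ⟨ψ, hψ⟩
  obtain ⟨b, hb⟩ := IsLocalization.exist_integer_multiples_of_finite (nonZeroDivisors ℤ) v
  choose w hw using hb
  have hw' : ∀ n, (w n : ℚ) = (b : ℤ) * v n := fun n => by
    have := hw n
    simpa using this
  have hb0 : ((b : ℤ) : ℚ) ≠ 0 := by exact_mod_cast nonZeroDivisors.coe_ne_zero b
  obtain ⟨n₀, hn₀⟩ := Function.ne_iff.mp hv0
  -- Dividing an integral solution by its gcd leaves coprime exponents, which no prime divides
  -- simultaneously.
  obtain ⟨i, hi, hi1⟩ := Finset.extract_gcd w (s := Finset.univ) ⟨n₀, Finset.mem_univ _⟩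
  have hg : Finset.univ.gcd w ≠ 0 := by
    intro h
    have h1 := hi n₀ (Finset.mem_univ _)
    rw [h, zero_mul] at h1
    have h2 := hw' n₀
    rw [h1] at h2
    exact mul_ne_zero hb0 hn₀ (by simpa using h2.symm)
  refine ⟨i, ?_, fun ψ hψ => ?_⟩
  · by_contra! h
    have h1 : (q : ℤ) ∣ 1 := hi1 ▸ Finset.dvd_gcd fun n _ => h n
    exact (Nat.prime_iff_prime_int.mp hq).not_dvd_one h1
  · have h1 : ∑ n, (i n : ℚ) * r ψ n = 0 := by
      have h2 : ((Finset.univ.gcd w : ℤ) : ℚ) * ∑ n, (i n : ℚ) * r ψ n =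
          ((b : ℤ) : ℚ) * ∑ n, r ψ n * v n := by
        rw [Finset.mul_sum, Finset.mul_sum]
        refine Finset.sum_congr rfl fun n _ => ?_
        have h3 : (w n : ℚ) = (Finset.univ.gcd w : ℤ) * i n := by exact_mod_cast hi n (Finset.mem_univ _)
        rw [← mul_assoc, ← h3, hw']
        ring
      rw [hv' ψ hψ, mul_zero] at h2
      exact (mul_eq_zero.mp h2).resolve_left (by exact_mod_cast hg)
    have h2 : ∀ n, ψ (u n ^ i n) =
        Multiplicative.ofAdd (((i n : ℚ) * r ψ n : ℚ) : AddCircle (1 : ℚ)) := fun n => by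
      rw [map_zpow, ← hr, ← ofAdd_zsmul, ← AddCircle.coe_zsmul, zsmul_eq_mul]
    rw [map_prod, Finset.prod_congr rfl fun n _ => h2 n, ← ofAdd_sum]
    have h3 : ∑ n, (((i n : ℚ) * r ψ n : ℚ) : AddCircle (1 : ℚ)) =
        ((∑ n, (i n : ℚ) * r ψ n : ℚ) : AddCircle (1 : ℚ)) :=
      (map_sum (QuotientAddGroup.mk' (AddSubgroup.zmultiples (1 : ℚ))) _ _).symm
    rw [h3, h1]
    rfl

/-- If every prime of P failed, the finite sets witnessing this would together generate some E such
that, for large n, the order of `c n` modulo E is prime to all of P, so `c n` lies in E. But a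
finitely generated abelian group has only finitely many torsion elements. -/
theorem exists_prime_forall_dvd {c : ℕ → V} (hc : Function.Injective c)
    (hfin : ∀ n, IsOfFinOrder (c n)) (P : Finset ℕ)
    (hP : ∀ n p, p.Prime → p ∣ orderOf (c n) → p ∈ P) :
    ∃ q : ℕ, q.Prime ∧ ∀ (S : Finset V) (N : ℕ), ∃ n ≥ N, ∀ i : ℤ,
      c n ^ i ∈ Subgroup.closure (S : Set V) → (q : ℤ) ∣ i := by
  classical
  by_contra! hcon
  have h1 : ∀ q : ℕ, ∃ (S : Finset V) (N : ℕ), q.Prime → ∀ n ≥ N, ∃ i : ℤ,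
      c n ^ i ∈ Subgroup.closure (S : Set V) ∧ ¬ (q : ℤ) ∣ i := fun q => by
    by_cases hq : q.Prime
    · obtain ⟨S, N, h⟩ := hcon q hq
      exact ⟨S, N, fun _ => h⟩
    · exact ⟨∅, 0, fun h => absurd h hq⟩
  choose S N hSN using h1
  set E := Subgroup.closure ((P.biUnion S : Finset V) : Set V)
  have h2 : ∀ n ≥ P.sup N, c n ∈ E := by
    intro n hn
    rw [← QuotientGroup.eq_one_iff, ← orderOf_eq_one_iff]
    by_contra hne
    have hp := Nat.minFac_prime hne
    set p := (orderOf (c n : V ⧸ E)).minFac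
    have hpdvd : p ∣ orderOf (c n : V ⧸ E) := Nat.minFac_dvd _
    have hpP : p ∈ P := hP n p hp (hpdvd.trans (orderOf_map_dvd (QuotientGroup.mk' E) (c n)))
    obtain ⟨i, hi, hpi⟩ := hSN p hp n ((Finset.le_sup hpP).trans hn)
    have hiE : c n ^ i ∈ E := Subgroup.closure_mono
      (Finset.coe_subset.mpr (Finset.subset_biUnion_of_mem S hpP)) hi
    rw [← QuotientGroup.eq_one_iff, QuotientGroup.mk_zpow, ← orderOf_dvd_iff_zpow_eq_one] at hiE
    exact hpi ((Int.natCast_dvd_natCast.mpr hpdvd).trans hiE)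
  have hE : E.FG := ⟨_, rfl⟩
  refine ((Set.Ici_infinite (P.sup N)).image hc.injOn) ((finite_torsion_of_fg hE).subset ?_)
  rintro _ ⟨n, hn, rfl⟩
  exact ⟨h2 n hn, hfin n⟩

theorem exists_finset_character {c : ℕ → V} {q : ℕ} (hq : q.Prime)
    (hc : ∀ (S : Finset V) (N : ℕ), ∃ n ≥ N, ∀ i : ℤ,
      c n ^ i ∈ Subgroup.closure (S : Set V) → (q : ℤ) ∣ i) (S : Finset V) (N k : ℕ) :
    ∃ F : Finset ℕ, F.card = k ∧ (∀ n ∈ F, N ≤ n) ∧ ∃ ψ : RatChar V, (∀ s ∈ S, ψ s = 1) ∧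
      ∀ n ∈ F, ∀ i : ℤ, ψ (c n ^ i) = 1 → (q : ℤ) ∣ i := by
  classical
  induction k with
  | zero => exact ⟨∅, rfl, by simp, 1, by simp, by simp⟩
  | succ k ih =>
    obtain ⟨F, hF, hN, ψ, hψ, hψc⟩ := ih
    obtain ⟨n, hn, hnc⟩ := hc (S ∪ F.image c) (max N (F.sup id + 1))
    obtain ⟨ψ', h1, h2⟩ := ψ.exists_extension _ (c n) hq hnc
    have hnF : n ∉ F := fun h => by
      have h3 : n ≤ F.sup id := Finset.le_sup (f := id) h
      have h4 := (le_max_right _ _).trans hn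
      omega
    refine ⟨insert n F, by rw [Finset.card_insert_of_notMem hnF, hF], ?_, ψ', ?_, ?_⟩
    · intro m hm
      rcases Finset.mem_insert.mp hm with rfl | hm
      exacts [(le_max_left _ _).trans hn, hN m hm]
    · intro s hs
      rw [h1 s (Subgroup.subset_closure (by simp [hs])), hψ s hs]
    · intro m hm i hi
      rcases Finset.mem_insert.mp hm with rfl | hm
      · exact h2 i hi
      · have h3 : c m ^ i ∈ Subgroup.closure ((S ∪ F.image c : Finset V) : Set V) :=
          Subgroup.zpow_mem _ (Subgroup.subset_closure (Finset.mem_coe.mpr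
            (Finset.mem_union_right _ (Finset.mem_image_of_mem c hm)))) i
        exact hψc m hm i (by rw [← h1 _ h3, hi])

/-- Elements of distinct prime orders are independent, so c_n ↦ 1/p_n is well defined on their span;
it extends by injectivity of ℚ/ℤ. -/
theorem exists_character_of_orderOf_prime {c : ℕ → V} {p : ℕ → ℕ} (hp : ∀ n, (p n).Prime)
    (hinj : Function.Injective p) (hc : ∀ n, orderOf (c n) = p n) :
    ∃ ψ : RatChar V, ∀ n, ψ (c n) ≠ 1 := by
  classical
  let f : (ℕ →₀ ℤ) →+ Additive V :=
    Finsupp.liftAddHom fun n => (zmultiplesHom (Additive V)) (Additive.ofMul (c n))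
  let g : (ℕ →₀ ℤ) →+ AddCircle (1 : ℚ) :=
    Finsupp.liftAddHom fun n => (zmultiplesHom (AddCircle (1 : ℚ))) (((1 / p n : ℚ)) : AddCircle (1 : ℚ))
  have hdvd : ∀ k, f k = 0 → ∀ n, (p n : ℤ) ∣ k n := by
    intro k hk n
    have hk' : ∑ m ∈ k.support, k m • Additive.ofMul (c m) = 0 := hk
    by_cases hn : n ∈ k.support
    · have hpc : ∀ m, (p m : ℤ) • Additive.ofMul (c m) = 0 := fun m => by
        rw [natCast_zsmul, ← ofMul_pow, ← hc m, pow_orderOf_eq_one, ofMul_one]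
      have h1 : ((∏ m ∈ k.support.erase n, (p m : ℤ)) * k n) • Additive.ofMul (c n) = 0 := by
        have h2 := congrArg ((∏ m ∈ k.support.erase n, (p m : ℤ)) • ·) hk'
        simp only [smul_zero] at h2
        rw [← Finset.add_sum_erase _ _ hn, smul_add, Finset.smul_sum, Finset.sum_eq_zero, add_zero,
          smul_smul] at h2
        · exact h2
        · intro m hm
          rw [← Finset.mul_prod_erase _ _ hm, smul_comm, mul_comm, mul_smul, hpc, smul_zero, smul_zero]
      have h3 : (p n : ℤ) ∣ (∏ m ∈ k.support.erase n, (p m : ℤ)) * k n := by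
        rw [← hc n, orderOf_dvd_iff_zpow_eq_one]
        exact h1
      have hpn : Prime (p n : ℤ) := Nat.prime_iff_prime_int.mp (hp n)
      refine (hpn.dvd_or_dvd h3).resolve_left fun h4 => ?_
      obtain ⟨m, hm, hmn⟩ := (hpn.dvd_finsetProd_iff _).mp h4
      have h5 := (Nat.prime_dvd_prime_iff_eq (hp n) (hp m)).mp (Int.natCast_dvd_natCast.mp hmn)
      exact (Finset.ne_of_mem_erase hm) (hinj h5).symm
    · rw [Finsupp.notMem_support_iff.mp hn]
      exact dvd_zero _
  have hker : f.rangeRestrict.ker ≤ g.ker := by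
    intro k hk
    have hk' : f k = 0 := by simpa using congrArg Subtype.val (show f.rangeRestrict k = 0 from hk)
    change k.sum _ = 0
    refine Finset.sum_eq_zero fun n _ => ?_
    obtain ⟨j, hj⟩ := hdvd k hk' n
    change k n • (((1 / p n : ℚ)) : AddCircle (1 : ℚ)) = 0
    have hpn : (p n : ℚ) ≠ 0 := by exact_mod_cast (hp n).ne_zero
    rw [hj, ← AddCircle.coe_zsmul, AddCircle.coe_eq_zero_iff]
    refine ⟨j, ?_⟩
    simp only [zsmul_eq_mul, Int.cast_mul, Int.cast_natCast]
    field_simp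
  let φ : f.range →+ AddCircle (1 : ℚ) :=
    f.rangeRestrict.liftOfSurjective f.rangeRestrict_surjective ⟨g, hker⟩
  obtain ⟨ψ, hψ⟩ := CharacterModule.dual_surjective_of_injective (R := ℤ)
    f.range.subtype.toIntLinearMap Subtype.val_injective φ
  let ψ' : Additive V →+ AddCircle (1 : ℚ) := ψ
  refine ⟨AddMonoidHom.toMultiplicativeRight ψ', fun n hn => ?_⟩
  have h1 : ψ' (f (Finsupp.single n 1)) = g (Finsupp.single n 1) := by
    have h2 := DFunLike.congr_fun hψ (f.rangeRestrict (Finsupp.single n 1))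
    have h3 : φ (f.rangeRestrict (Finsupp.single n 1)) = g (Finsupp.single n 1) :=
      f.rangeRestrict.liftOfRightInverse_comp_apply _ _ ⟨g, hker⟩ _
    exact h2.trans h3
  have h4 : f (Finsupp.single n 1) = Additive.ofMul (c n) := by simp [f]
  have h5 : g (Finsupp.single n 1) = ((1 / p n : ℚ) : AddCircle (1 : ℚ)) := by simp [g]
  rw [h4, h5] at h1
  have h6 : ((1 / p n : ℚ) : AddCircle (1 : ℚ)) = 0 := h1.symm.trans hn
  obtain ⟨j, hj⟩ := AddCircle.coe_eq_zero_iff _ |>.mp h6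
  have hpn : (p n : ℚ) ≠ 0 := by exact_mod_cast (hp n).ne_zero
  have h7 : j * (p n : ℤ) = 1 := by
    have h8 : (j : ℚ) * p n = 1 := by
      rw [zsmul_eq_mul, mul_one] at hj
      rw [hj]
      field_simp
    exact_mod_cast h8
  exact (Nat.prime_iff_prime_int.mp (hp n)).not_dvd_one ⟨j, by rw [← h7, mul_comm]⟩

end Characters


/-! ### Pairs with central commutators whose orders involve finitely many primes -/

section CentralPairs

variable {G : Type*} [Group G]

/-- Commuting pairs whose commutators are central in the subgroup generated by all the pairs. -/
structure CentralPairs (x y : ℕ → G) : Prop extends CommutingPairs x y where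
  cx : ∀ m n, Commute ⁅x m, y m⁆ (x n)
  cy : ∀ m n, Commute ⁅x m, y m⁆ (y n)

theorem CommutingPairs.centralPairs {x y : ℕ → G} (h : CommutingPairs x y)
    (hx : ∀ n, Commute ⁅x n, y n⁆ (x n)) (hy : ∀ n, Commute ⁅x n, y n⁆ (y n)) :
    CentralPairs x y where
  toCommutingPairs := h
  cx m n := by
    rcases eq_or_ne m n with rfl | hmn
    exacts [hx m, h.commute_commutator_x hmn]
  cy m n := by
    rcases eq_or_ne m n with rfl | hmn
    · exact hy m
    · rw [← commutatorElement_inv]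
      exact (h.swap.commute_commutator_x hmn).inv_left

namespace CentralPairs

variable {x y : ℕ → G}

theorem comp (h : CentralPairs x y) {f : ℕ → ℕ} (hf : Function.Injective f) :
    CentralPairs (x ∘ f) (y ∘ f) where
  toCommutingPairs := h.toCommutingPairs.comp hf
  cx _ _ := h.cx _ _
  cy _ _ := h.cy _ _

theorem commutator_pow (h : CentralPairs x y) (k n : ℕ) : ⁅x n ^ k, y n⁆ = ⁅x n, y n⁆ ^ k := by
  simpa using commutatorElement_zpow_left (h.cx n n) k

theorem pow (h : CentralPairs x y) (k : ℕ → ℕ) (hk : ∀ n, ⁅x n, y n⁆ ^ k n ≠ 1) :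
    CentralPairs (fun n => x n ^ k n) y where
  xx m n := (h.xx m n).pow_pow _ _
  yy := h.yy
  xy m n hmn := (h.xy m n hmn).pow_left _
  ne n := by rw [h.commutator_pow]; exact hk n
  cx m n := by rw [h.commutator_pow]; exact (h.cx m n).pow_pow _ _
  cy m n := by rw [h.commutator_pow]; exact (h.cy m n).pow_left _

theorem isOfFinOrder (h : CentralPairs x y) (hFC : ∀ g : G, (conjugatesOf g).Finite) (n : ℕ) :
    IsOfFinOrder ⁅x n, y n⁆ := by
  have h1 := finiteIndex_centralizer_singleton (hFC (y n))
  obtain ⟨k, hk0, -, hk⟩ := Subgroup.exists_pow_mem_of_index_ne_zero h1.index_ne_zero (x n)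
  rw [isOfFinOrder_iff_pow_eq_one]
  refine ⟨k, hk0, ?_⟩
  rw [← h.commutator_pow, commutatorElement_eq_one_iff_commute]
  exact Subgroup.mem_centralizer_singleton_iff.mp hk

end CentralPairs

theorem exists_centralPairs {χ : Subgroup G → Prop} (hχ : IsTame χ) (hG : AntichainCondition G χ)
    (hFC : ∀ g : G, (conjugatesOf g).Finite) (hinf : ¬ Finite (commutator G)) :
    ∃ x y : ℕ → G, CentralPairs x y ∧ Function.Injective fun n => ⁅x n, y n⁆ := by
  classical
  obtain ⟨x, y, h, -, -, hR⟩ := exists_commutingPairs hFC ⊤ (fun s z => z ∉ s) (fun C _ s => by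
    by_contra! hcon
    refine hinf (finite_commutator_of_finiteIndex hFC C ((insert 1 s).finite_toSet.subset ?_))
    rintro _ ⟨x, hx, y, hy, rfl⟩
    by_cases h1 : ⁅x, y⁆ = 1
    · rw [h1]; exact Finset.mem_coe.mpr (Finset.mem_insert_self _ _)
    · exact Finset.mem_coe.mpr (Finset.mem_insert_of_mem (hcon x hx y hy h1)))
  have hlt : ∀ m n, m < n → ⁅x m, y m⁆ ≠ ⁅x n, y n⁆ := fun m n hmn e => hR n (by
    rw [← e]
    exact Finset.mem_image_of_mem (fun m => ⁅x m, y m⁆) (Finset.mem_range.mpr hmn))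
  have hinj : Function.Injective fun n => ⁅x n, y n⁆ := fun m n hmn => by
    rcases lt_trichotomy m n with h | h | h
    exacts [absurd hmn (hlt m n h), h, absurd hmn.symm (hlt n m h)]
  obtain ⟨f, hf, hfx⟩ := h.exists_commute_commutator hχ hG
  obtain ⟨f', hf', hfy⟩ := (h.comp hf).swap.exists_commute_commutator hχ hG
  refine ⟨_, _, ((h.comp hf).comp hf').centralPairs (fun n => hfx _) (fun n => ?_),
    (hinj.comp hf).comp hf'⟩
  rw [← commutatorElement_inv]
  exact (hfy n).inv_left

section Products

variable {L : Subgroup G} [IsMulCommutative L] {u : ℕ → L} {y : ℕ → G}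

theorem commute_prod (h : ∀ m n, m ≠ n → Commute (u m : G) (y n)) (i : ℕ → ℤ) {F : Finset ℕ} {m : ℕ}
    (hm : m ∉ F) : Commute ((∏ n ∈ F, u n ^ i n : L) : G) (y m) := by
  have h1 : ∏ n ∈ F, u n ^ i n ∈ (Subgroup.centralizer {y m}).comap L.subtype := by
    refine Subgroup.prod_mem _ fun n hn => Subgroup.zpow_mem _ ?_ _
    exact Subgroup.mem_centralizer_singleton_iff.mpr (h n m (fun e => hm (e ▸ hn)))
  exact Subgroup.mem_centralizer_singleton_iff.mp h1

theorem commutator_prod (h : ∀ m n, m ≠ n → Commute (u m : G) (y n)) (i : ℕ → ℤ) {F : Finset ℕ}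
    {m : ℕ} (hm : m ∈ F) :
    ⁅((∏ n ∈ F, u n ^ i n : L) : G), y m⁆ = ⁅(u m : G) ^ i m, y m⁆ := by
  classical
  have h1 := commute_prod h i (Finset.notMem_erase m F)
  rw [← Finset.mul_prod_erase F _ hm, Subgroup.coe_mul, commutatorElement_def, commutatorElement_def,
    mul_assoc ((u m ^ i m : L) : G), h1.eq, Subgroup.coe_zpow]
  group

end Products

variable {x y : ℕ → G}

/-- The subgroup generated by the first members of the pairs and by the commutators. -/
def pairSubgroup (x y : ℕ → G) : Subgroup G :=
  Subgroup.closure (Set.range x ∪ Set.range fun n => ⁅x n, y n⁆)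

theorem CentralPairs.isMulCommutative (h : CentralPairs x y) :
    IsMulCommutative (pairSubgroup x y) := by
  refine Subgroup.isMulCommutative_closure ?_
  have hc : ∀ m n, Commute ⁅x m, y m⁆ ⁅x n, y n⁆ := fun m n => by
    rw [commutatorElement_def (x n)]
    exact (((h.cx m n).mul_right (h.cy m n)).mul_right (h.cx m n).inv_right).mul_right
      (h.cy m n).inv_right
  rintro _ (⟨m, rfl⟩ | ⟨m, rfl⟩) _ (⟨n, rfl⟩ | ⟨n, rfl⟩)
  exacts [h.xx m n, (h.cx n m).symm, h.cx m n, hc m n]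

/-- The element `x n`, in the subgroup `pairSubgroup x y`. -/
def pairElement (x y : ℕ → G) (n : ℕ) : pairSubgroup x y :=
  ⟨x n, Subgroup.subset_closure (Or.inl ⟨n, rfl⟩)⟩

/-- The commutator of `x n` and `y n`, in the subgroup `pairSubgroup x y`. -/
def pairCommutator (x y : ℕ → G) (n : ℕ) : pairSubgroup x y :=
  ⟨⁅x n, y n⁆, Subgroup.subset_closure (Or.inr ⟨n, rfl⟩)⟩

/-- The hypotheses on products of powers over disjoint blocks under which the antichain condition
applies. -/
structure Blocks (x y : ℕ → G) (F : ℕ → Finset ℕ) (i : ℕ → ℕ → ℤ) (e : ℕ → ℕ) : Prop where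
  disjoint : ∀ m n, m ≠ n → Disjoint (F m) (F n)
  mem : ∀ n, e n ∈ F n
  ne : ∀ n, ⁅x (e n), y (e n)⁆ ^ i n (e n) ≠ 1

namespace Blocks

variable {F : ℕ → Finset ℕ} {i : ℕ → ℕ → ℤ} {e : ℕ → ℕ}

theorem commute (hb : Blocks x y F i e) (h : CentralPairs x y) [IsMulCommutative (pairSubgroup x y)]
    {m n : ℕ} (hmn : m ≠ n) :
    Commute ((∏ k ∈ F m, pairElement x y k ^ i m k : pairSubgroup x y) : G) (y (e n)) :=
  commute_prod (u := pairElement x y) h.xy (i m)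
    (Finset.disjoint_right.mp (hb.disjoint m n hmn) (hb.mem n))

theorem commutator (hb : Blocks x y F i e) (h : CentralPairs x y)
    [IsMulCommutative (pairSubgroup x y)] (n : ℕ) :
    ⁅((∏ k ∈ F n, pairElement x y k ^ i n k : pairSubgroup x y) : G), y (e n)⁆ =
      ((pairCommutator x y (e n) ^ i n (e n) : pairSubgroup x y) : G) :=
  (commutator_prod (u := pairElement x y) h.xy (i n) (hb.mem n)).trans
    (commutatorElement_zpow_left (h.cx _ _) _)

theorem notMem_closure (hb : Blocks x y F i e) (h : CentralPairs x y)
    [IsMulCommutative (pairSubgroup x y)] (n : ℕ) :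
    ((∏ k ∈ F n, pairElement x y k ^ i n k : pairSubgroup x y) : G) ∉ Subgroup.closure
      ((fun m => ((∏ k ∈ F m, pairElement x y k ^ i m k : pairSubgroup x y) : G)) ''
        {m | m ≠ n}) := by
  refine notMem_closure_of_not_commute (h := fun m =>
    ((∏ k ∈ F m, pairElement x y k ^ i m k : pairSubgroup x y) : G)) (y := y (e n)) ?_
    fun m hm => hb.commute h hm
  rw [← commutatorElement_eq_one_iff_commute, hb.commutator h]
  exact hb.ne n

theorem apply_eq_one {L : Subgroup G} [IsMulCommutative L] (ψ : RatChar L) {v : ℕ → L}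
    (hv : ∀ n, ψ (v n) = 1) {w : L} (hw : (w : G) ∈ Subgroup.closure (Set.range fun n => (v n : G))) :
    ψ w = 1 := by
  have h1 : Subgroup.closure (Set.range fun n => (v n : G)) ≤ ψ.ker.map L.subtype := by
    rw [Subgroup.closure_le]
    rintro _ ⟨n, rfl⟩
    exact ⟨v n, hv n, rfl⟩
  obtain ⟨w', hw', e⟩ := h1 hw
  rw [← Subtype.val_injective e]
  exact hw'

end Blocks

theorem exists_block
    [IsMulCommutative (pairSubgroup x y)] {q : ℕ} (hq : q.Prime) (F : Finset ℕ)
    (Ψ : Finset (RatChar (pairSubgroup x y))) (hF : Ψ.card < F.card) :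
    ∃ (i : ℕ → ℤ) (e : ℕ), e ∈ F ∧ ¬ (q : ℤ) ∣ i e ∧
      ∀ ψ ∈ Ψ, ψ (∏ k ∈ F, pairElement x y k ^ i k) = 1 := by
  classical
  obtain ⟨i, ⟨e, he⟩, hi⟩ := exists_prod_zpow_forall_eq_one hq Ψ
    (fun k : F => pairElement x y k) (by simpa using hF)
  refine ⟨fun k => if hk : k ∈ F then i ⟨k, hk⟩ else 0, e, e.2, by simpa using he, fun ψ hψ => ?_⟩
  rw [← hi ψ hψ, ← Finset.prod_coe_sort F]
  simp

/-- Blocks are built with characters ψ_m that kill every block product and every earlier commutator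
power, but not that of block m. Since the quotient of two commutator powers lies in the span of the
block products, applying ψ_m gives a contradiction. -/
theorem CentralPairs.false_of_finite_primes {χ : Subgroup G → Prop} (hχ : IsTame χ)
    (hG : AntichainCondition G χ) (h : CentralPairs x y)
    (hinj : Function.Injective fun n => ⁅x n, y n⁆) (hfin : ∀ n, IsOfFinOrder ⁅x n, y n⁆)
    (P : Finset ℕ) (hP : ∀ n p, p.Prime → p ∣ orderOf ⁅x n, y n⁆ → p ∈ P) : False := by
  classical
  have := h.isMulCommutative
  have hc : Function.Injective (pairCommutator x y) := fun m n hmn =>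
    hinj (Subtype.ext_iff.mp hmn)
  obtain ⟨q, hq, hqc⟩ := exists_prime_forall_dvd hc
    (fun n => Submonoid.isOfFinOrder_coe.mp (hfin n)) P
    (fun n p hp hpn => hP n p hp (by rwa [← Subgroup.orderOf_coe] at hpn))
  let H : RatChar (pairSubgroup x y) × Finset ℕ × (ℕ → ℤ) × ℕ → pairSubgroup x y :=
    fun t => ∏ k ∈ t.2.1, pairElement x y k ^ t.2.2.1 k
  let D : RatChar (pairSubgroup x y) × Finset ℕ × (ℕ → ℤ) × ℕ → pairSubgroup x y :=
    fun t => pairCommutator x y t.2.2.2 ^ t.2.2.1 t.2.2.2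
  obtain ⟨f, hf⟩ := exists_seq_of_forall_finset
    (fun (s : Finset (RatChar (pairSubgroup x y) × Finset ℕ × (ℕ → ℤ) × ℕ)) t =>
      t.2.2.2 ∈ t.2.1 ∧ t.1 (H t) = 1 ∧ t.1 (D t) ≠ 1 ∧ ∀ r ∈ s, Disjoint r.2.1 t.2.1 ∧
        t.1 (H r) = 1 ∧ t.1 (D r) = 1 ∧ r.1 (H t) = 1) (fun s => by
      obtain ⟨F, hF, hFN, ψ, hψ, hψc⟩ := exists_finset_character hq hqc (s.image H ∪ s.image D)
        ((s.biUnion fun r => r.2.1).sup id + 1) (s.card + 2)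
      -- The block is longer than the number of earlier characters plus the new one, so exponents
      -- exist that make its product invisible to all of them.
      have hcard : (insert ψ (s.image Prod.fst)).card < F.card := by
        have h1 := Finset.card_insert_le ψ (s.image Prod.fst)
        have h2 := Finset.card_image_le (s := s) (f := Prod.fst)
        omega
      obtain ⟨i, e, he, hie, hi⟩ := exists_block hq F _ hcard
      refine ⟨(ψ, F, i, e), he, hi ψ (Finset.mem_insert_self _ _), fun h1 => hie (hψc e he _ h1),
        fun r hr => ⟨?_, hψ _ (Finset.mem_union_left _ (Finset.mem_image_of_mem H hr)),
          hψ _ (Finset.mem_union_right _ (Finset.mem_image_of_mem D hr)),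
          hi _ (Finset.mem_insert_of_mem (Finset.mem_image_of_mem _ hr))⟩⟩
      rw [Finset.disjoint_left]
      intro k hk hkF
      have h1 : k ≤ (s.biUnion fun r => r.2.1).sup id :=
        Finset.le_sup (f := id) (Finset.mem_biUnion.mpr ⟨r, hr, hk⟩)
      have h2 := hFN k hkF
      omega)
  have hlt : ∀ m n, m < n → _ := fun m n hmn => (hf n).2.2.2 (f m)
    (Finset.mem_image_of_mem f (Finset.mem_range.mpr hmn))
  have hb : Blocks x y (fun n => (f n).2.1) (fun n => (f n).2.2.1) (fun n => (f n).2.2.2) := by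
    refine ⟨fun m n hmn => ?_, fun n => (hf n).1, fun n h1 => (hf n).2.2.1 ?_⟩
    · rcases lt_or_gt_of_ne hmn with h | h
      exacts [(hlt m n h).1, (hlt n m h).1.symm]
    · have h2 : D (f n) = 1 := Subtype.ext h1
      rw [h2, map_one]
  obtain ⟨J, hJ, hJ'⟩ := hχ.exists_commutator_mem hG (fun n => (H (f n) : G))
    (fun n => y (f n).2.2.2) (fun m n => congrArg Subtype.val (mul_comm (H (f m)) (H (f n))))
    (fun n => hb.notMem_closure h n) (fun m n hmn => hb.commute h hmn.ne)
  obtain ⟨n, hn⟩ := hJ.nonempty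
  obtain ⟨m, hm, hnm⟩ := hJ.exists_gt n
  have h1 := hJ' n hn m hm
  rw [hb.commutator h, hb.commutator h] at h1
  have h2 : (f m).1 ((D (f n))⁻¹ * D (f m)) = 1 := by
    refine Blocks.apply_eq_one (f m).1 (v := fun n => H (f n)) (fun k => ?_) h1
    rcases lt_trichotomy k m with h | rfl | h
    exacts [(hlt k m h).2.1, (hf k).2.1, (hlt m k h).2.2.2]
  rw [map_mul, map_inv, (hlt n m hnm).2.2.1, inv_one, one_mul] at h2
  exact (hf m).2.2.1 h2

end CentralPairs


/-! ### Commutators of distinct prime orders, and the final contradictions -/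

section DistinctPrimes

variable {G : Type*} [Group G]

theorem mul_pow_of_commute_commutator {a b : G} (ha : Commute ⁅b, a⁆ a) (hb : Commute ⁅b, a⁆ b)
    (n : ℕ) : (a * b) ^ n = a ^ n * b ^ n * ⁅b, a⁆ ^ (n * (n - 1) / 2) := by
  have h1 : ∀ n : ℕ, b ^ n * a = a * b ^ n * ⁅b, a⁆ ^ n := fun n => by
    have h2 := commutatorElement_zpow_left hb n
    rw [zpow_natCast, zpow_natCast, commutatorElement_def] at h2
    have h3 : b ^ n * a = ⁅b, a⁆ ^ n * (a * b ^ n) := by rw [← h2]; group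
    rw [h3]
    exact ((ha.mul_right (hb.pow_right n)).pow_left n).eq
  have h2 : ∀ n : ℕ, (n + 1) * (n + 1 - 1) / 2 = n * (n - 1) / 2 + n := fun n => by
    rw [← Finset.sum_range_id_mul_two, ← Finset.sum_range_id_mul_two, Nat.mul_div_cancel _ two_pos,
      Nat.mul_div_cancel _ two_pos, Finset.sum_range_succ]
  induction n with
  | zero => simp
  | succ n ih =>
    have h3 : Commute (⁅b, a⁆ ^ (n * (n - 1) / 2)) (a * b) := (ha.mul_right hb).pow_left _
    have h4 : Commute (⁅b, a⁆ ^ n) b := hb.pow_left _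
    calc (a * b) ^ (n + 1) = a ^ n * b ^ n * (⁅b, a⁆ ^ (n * (n - 1) / 2) * (a * b)) := by
          rw [pow_succ, ih, mul_assoc]
      _ = a ^ n * (b ^ n * a) * b * ⁅b, a⁆ ^ (n * (n - 1) / 2) := by
          rw [h3.eq]; simp only [mul_assoc]
      _ = a ^ n * a * b ^ n * (⁅b, a⁆ ^ n * b) * ⁅b, a⁆ ^ (n * (n - 1) / 2) := by
          rw [h1]; simp only [mul_assoc]
      _ = a ^ n * a * (b ^ n * b) * (⁅b, a⁆ ^ (n * (n - 1) / 2) * ⁅b, a⁆ ^ n) := by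
          rw [h4.eq, ← pow_add, add_comm, pow_add]; simp only [mul_assoc]
      _ = _ := by rw [← pow_succ, ← pow_succ, ← pow_add, h2]

variable {x y : ℕ → G}

/-- The centre of the subgroup generated by all the pairs. -/
def pairCenter (x y : ℕ → G) : Subgroup G :=
  Subgroup.centralizer (Set.range x ∪ Set.range y) ⊓ Subgroup.closure (Set.range x ∪ Set.range y)

instance isMulCommutative_pairCenter (x y : ℕ → G) : IsMulCommutative (pairCenter x y) := by
  refine ⟨⟨fun a b => Subtype.ext ?_⟩⟩
  have h1 : Subgroup.closure (Set.range x ∪ Set.range y) ≤ Subgroup.centralizer {(a : G)} := by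
    rw [Subgroup.closure_le]
    exact fun z hz => Subgroup.mem_centralizer_singleton_iff.mpr
      (Subgroup.mem_centralizer_iff.mp a.2.1 z hz)
  exact (Subgroup.mem_centralizer_singleton_iff.mp (h1 b.2.2)).symm

theorem mem_pairCenter {z : G} (hz : z ∈ Subgroup.closure (Set.range x ∪ Set.range y))
    (hx : ∀ n, Commute z (x n)) (hy : ∀ n, Commute z (y n)) : z ∈ pairCenter x y := by
  refine ⟨Subgroup.mem_centralizer_iff.mpr ?_, hz⟩
  rintro _ (⟨n, rfl⟩ | ⟨n, rfl⟩)
  exacts [(hx n).eq.symm, (hy n).eq.symm]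

theorem commute_of_mem_pairCenter {z : G} (hz : z ∈ pairCenter x y) (n : ℕ) :
    Commute z (x n) ∧ Commute z (y n) :=
  ⟨(Subgroup.mem_centralizer_iff.mp hz.1 _ (Or.inl ⟨n, rfl⟩)).symm,
    (Subgroup.mem_centralizer_iff.mp hz.1 _ (Or.inr ⟨n, rfl⟩)).symm⟩

namespace CentralPairs

theorem swap (h : CentralPairs x y) : CentralPairs y x :=
  h.toCommutingPairs.swap.centralPairs
    (fun n => by rw [← commutatorElement_inv]; exact (h.cy n n).inv_left)
    (fun n => by rw [← commutatorElement_inv]; exact (h.cx n n).inv_left)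

theorem x_mem (n : ℕ) : x n ∈ Subgroup.closure (Set.range x ∪ Set.range y) :=
  Subgroup.subset_closure (Or.inl ⟨n, rfl⟩)

theorem y_mem (n : ℕ) : y n ∈ Subgroup.closure (Set.range x ∪ Set.range y) :=
  Subgroup.subset_closure (Or.inr ⟨n, rfl⟩)

theorem commutator_mem (h : CentralPairs x y) (n : ℕ) : ⁅x n, y n⁆ ∈ pairCenter x y := by
  refine mem_pairCenter ?_ (h.cx n) (h.cy n)
  rw [commutatorElement_def]
  exact Subgroup.mul_mem _ (Subgroup.mul_mem _ (Subgroup.mul_mem _ (x_mem n) (y_mem n))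
    (Subgroup.inv_mem _ (x_mem n))) (Subgroup.inv_mem _ (y_mem n))

theorem x_pow_mem (h : CentralPairs x y) {n k : ℕ} (hk : ⁅x n, y n⁆ ^ k = 1) :
    x n ^ k ∈ pairCenter x y := by
  refine mem_pairCenter (Subgroup.pow_mem _ (x_mem n) _) (fun m => (h.xx n m).pow_left _) fun m => ?_
  rcases eq_or_ne n m with rfl | hnm
  · rw [← commutatorElement_eq_one_iff_commute, h.commutator_pow, hk]
  · exact (h.xy n m hnm).pow_left _

theorem y_pow_mem (h : CentralPairs x y) {n k : ℕ} (hk : ⁅x n, y n⁆ ^ k = 1) :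
    y n ^ k ∈ pairCenter x y := by
  have h1 := h.swap.x_pow_mem (n := n) (k := k) (by rw [← commutatorElement_inv, inv_pow, hk, inv_one])
  rwa [pairCenter, Set.union_comm] at h1

/-- Each pair contains an element that forms a noncommuting pair with a suitable product of powers
whose `p`-th power is annihilated by a given character. -/
theorem exists_annihilated (h : CentralPairs x y) (ψ : RatChar (pairCenter x y)) {p n : ℕ}
    (hp : p.Prime) (hp2 : p ≠ 2) (hc : orderOf ⁅x n, y n⁆ = p) :
    ∃ (i j e : ℤ) (g : G), (g = x n ∨ g = y n) ∧ ¬ (p : ℤ) ∣ e ∧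
      ⁅x n ^ i * y n ^ j, g⁆ = ⁅x n, y n⁆ ^ e ∧
      ∃ hm : (x n ^ i * y n ^ j) ^ p ∈ pairCenter x y, ψ ⟨_, hm⟩ = 1 := by
  have hcp : ⁅x n, y n⁆ ^ p = 1 := by rw [← hc, pow_orderOf_eq_one]
  obtain ⟨i, hi, hψ⟩ := exists_prod_zpow_forall_eq_one hp {ψ}
    ![(⟨_, h.x_pow_mem hcp⟩ : pairCenter x y), ⟨_, h.y_pow_mem hcp⟩] (by simp)
  have hψ' := hψ ψ (Finset.mem_singleton_self _)
  rw [Fin.prod_univ_two] at hψ'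
  simp only [Matrix.cons_val_zero, Matrix.cons_val_one] at hψ'
  have h1 : ⁅x n ^ i 0, y n⁆ = ⁅x n, y n⁆ ^ i 0 := commutatorElement_zpow_left (h.cx n n) _
  have h2 : ⁅y n ^ i 1, x n⁆ = ⁅x n, y n⁆ ^ (-i 1) := by
    rw [commutatorElement_zpow_left (h.swap.cx n n), ← commutatorElement_inv, inv_zpow, zpow_neg]
  have h3 : ⁅y n ^ i 1, x n ^ i 0⁆ = ⁅x n, y n⁆ ^ (-i 1 * i 0) := by
    have h4 : Commute ⁅x n, y n ^ i 1⁆ (x n) := by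
      rw [← commutatorElement_inv, h2]
      exact ((h.cx n n).zpow_left _).inv_left
    rw [← commutatorElement_inv, commutatorElement_zpow_left h4, ← commutatorElement_inv (y n ^ i 1),
      h2, inv_zpow, inv_inv, zpow_mul]
  have h4 : (x n ^ i 0 * y n ^ i 1) ^ p = (x n ^ p) ^ i 0 * (y n ^ p) ^ i 1 := by
    have h5 : ∀ z, Commute ⁅x n, y n⁆ z → Commute ⁅y n ^ i 1, x n ^ i 0⁆ z := fun z hz => by
      rw [h3]; exact hz.zpow_left _
    rw [mul_pow_of_commute_commutator (h5 _ ((h.cx n n).zpow_right _)) (h5 _ ((h.cy n n).zpow_right _)),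
      h3]
    obtain ⟨k, hk⟩ := hp.odd_of_ne_two hp2
    -- For odd p the binomial exponent is a multiple of p, so the commutator term in the p-th power
    -- of the product vanishes.
    have h6 : p * (p - 1) / 2 = p * k := by
      rw [hk, Nat.add_sub_cancel, mul_left_comm, Nat.mul_div_cancel_left _ two_pos]
    have h7 : (⁅x n, y n⁆ ^ (-i 1 * i 0)) ^ (p * k) = 1 := by
      rw [← zpow_natCast, ← zpow_mul, mul_comm, zpow_mul, zpow_natCast, pow_mul, hcp, one_pow, one_zpow]
    rw [h6, h7, mul_one]
    simp only [← zpow_natCast, ← zpow_mul, mul_comm]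
  have h5 : (x n ^ i 0 * y n ^ i 1) ^ p ∈ pairCenter x y := by
    rw [h4]
    exact Subgroup.mul_mem _ (Subgroup.zpow_mem _ (h.x_pow_mem hcp) _)
      (Subgroup.zpow_mem _ (h.y_pow_mem hcp) _)
  have h6 : ψ ⟨_, h5⟩ = 1 := by
    rw [← hψ']
    congr 1
    exact Subtype.ext h4
  obtain ⟨k, hk⟩ := hi
  by_cases hi0 : (p : ℤ) ∣ i 0
  · have hi1 : ¬ (p : ℤ) ∣ -i 1 := by
      rw [dvd_neg]
      fin_cases k
      exacts [absurd hi0 hk, hk]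
    refine ⟨i 0, i 1, -i 1, x n, Or.inl rfl, hi1, ?_, h5, h6⟩
    have h7 : Commute ⁅y n ^ i 1, x n⁆ (x n ^ i 0) := by
      rw [h2]; exact ((h.cx n n).zpow_left _).zpow_right _
    calc ⁅x n ^ i 0 * y n ^ i 1, x n⁆ = x n ^ i 0 * ⁅y n ^ i 1, x n⁆ * (x n ^ i 0)⁻¹ := by
          rw [commutatorElement_def, commutatorElement_def]; group
      _ = _ := by rw [← h7.eq, mul_inv_cancel_right, h2]
  · refine ⟨i 0, i 1, i 0, y n, Or.inr rfl, hi0, ?_, h5, h6⟩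
    rw [← h1, commutatorElement_def, commutatorElement_def]
    group

/-- No single prime recurs here, so each pair is treated alone: a_n = x_n ^ i * y_n ^ j has its
p_n-th power in the kernel of one ψ that is nontrivial on every c_n. -/
theorem false_of_injective_primes {χ : Subgroup G → Prop} (hχ : IsTame χ)
    (hG : AntichainCondition G χ) (h : CentralPairs x y) {p : ℕ → ℕ} (hp : ∀ n, (p n).Prime)
    (hp2 : ∀ n, p n ≠ 2) (hinj : Function.Injective p) (hc : ∀ n, orderOf ⁅x n, y n⁆ = p n) :
    False := by
  classical
  obtain ⟨ψ, hψ⟩ := exists_character_of_orderOf_prime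
    (c := fun n => (⟨_, h.commutator_mem n⟩ : pairCenter x y)) hp hinj
    (fun n => by rw [← Subgroup.orderOf_coe]; exact hc n)
  choose i j e g hg he hgc hm hψm using fun n => h.exists_annihilated ψ (hp n) (hp2 n) (hc n)
  set a : ℕ → G := fun n => x n ^ i n * y n ^ j n with ha
  have hcomm : ∀ m n, m ≠ n → Commute (a m) (x n) ∧ Commute (a m) (y n) := fun m n hmn =>
    ⟨((h.xx m n).zpow_left _).mul_left ((h.xy n m hmn.symm).symm.zpow_left _),
      ((h.xy m n hmn).zpow_left _).mul_left ((h.yy m n).zpow_left _)⟩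
  have haa : ∀ m n, Commute (a m) (a n) := fun m n => by
    rcases eq_or_ne m n with rfl | hmn
    · exact Commute.refl _
    · exact ((hcomm m n hmn).1.zpow_right _).mul_right ((hcomm m n hmn).2.zpow_right _)
  have hag : ∀ m n, m ≠ n → Commute (a m) (g n) := fun m n hmn => by
    rcases hg n with e | e <;> rw [e]
    exacts [(hcomm m n hmn).1, (hcomm m n hmn).2]
  have hdvd : ∀ n (k : ℤ), ⁅x n, y n⁆ ^ k = 1 → (p n : ℤ) ∣ k := fun n k hk => by
    rw [← hc n]; exact orderOf_dvd_iff_zpow_eq_one.mpr hk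
  have hd : ∀ n, Commute ⁅a n, g n⁆ (a n) := fun n => by
    rw [hgc]
    exact (((h.cx n n).zpow_right _).mul_right ((h.cy n n).zpow_right _)).zpow_left _
  have hirr : ∀ n, a n ∉ Subgroup.closure (a '' {m | m ≠ n}) := fun n =>
    notMem_closure_of_not_commute (y := g n) (fun hn => he n (hdvd n _ (by
      rw [← hgc]; exact commutatorElement_eq_one_iff_commute.mpr hn))) fun m hmn => hag m n hmn
  have hH : IsMulCommutative (Subgroup.closure (Set.range a)) := by
    refine Subgroup.isMulCommutative_closure ?_
    rintro _ ⟨m, rfl⟩ _ ⟨n, rfl⟩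
    exact haa m n
  -- A central w in the span of the a's is a product of powers `a n ^ k n`. Commuting with `g n`
  -- forces p_n to divide `k n`, so w is a product of powers of the elements `a n ^ p n` killed by
  -- ψ.
  have key : ∀ w (hw : w ∈ pairCenter x y), w ∈ Subgroup.closure (Set.range a) → ψ ⟨w, hw⟩ = 1 := by
    intro w hw hwa
    let a' : ℕ → Subgroup.closure (Set.range a) := fun n => ⟨a n, Subgroup.subset_closure ⟨n, rfl⟩⟩
    have h1 : (⟨w, hwa⟩ : Subgroup.closure (Set.range a)) ∈ Subgroup.closure (Set.range a') := by
      have h2 : (Subgroup.closure (Set.range a')).map (Subgroup.subtype _) =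
          Subgroup.closure (Set.range a) := by
        rw [MonoidHom.map_closure, ← Set.range_comp]
        rfl
      obtain ⟨w', hw', e⟩ := h2.symm.le hwa
      have h3 : w' = ⟨w, hwa⟩ := Subtype.ext e
      exact h3 ▸ hw'
    obtain ⟨k, hk⟩ := Subgroup.exists_finsupp_of_mem_closure_range a' _ h1
    have hk' : w = ((∏ n ∈ k.support, a' n ^ k n : Subgroup.closure (Set.range a)) : G) :=
      congrArg Subtype.val hk
    have h2 : ⟨w, hwa⟩ ∈ (ψ.ker.map (pairCenter x y).subtype).comap
        (Subgroup.closure (Set.range a)).subtype := by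
      rw [hk]
      refine Subgroup.prod_mem _ fun n hn => ?_
      have h3 : ⁅w, g n⁆ = ⁅a n ^ k n, g n⁆ := by
        rw [hk']
        exact commutator_prod (u := a') (y := g) hag k hn
      have h4 : ⁅w, g n⁆ = 1 := by
        rw [commutatorElement_eq_one_iff_commute]
        rcases hg n with e | e <;> rw [e]
        exacts [(commute_of_mem_pairCenter hw n).1, (commute_of_mem_pairCenter hw n).2]
      rw [h4, commutatorElement_zpow_left (hd n), hgc, ← zpow_mul] at h3
      obtain ⟨l, hl⟩ := ((Nat.prime_iff_prime_int.mp (hp n)).dvd_or_dvd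
        (hdvd n _ h3.symm)).resolve_left (he n)
      refine ⟨⟨_, hm n⟩ ^ l, Subgroup.zpow_mem _ (hψm n) l, ?_⟩
      change (a n ^ p n) ^ l = a n ^ k n
      rw [hl, zpow_mul, zpow_natCast]
    obtain ⟨w', hw', e⟩ := h2
    have h3 : w' = ⟨w, hw⟩ := Subtype.ext e
    exact h3 ▸ hw'
  obtain ⟨J, hJ, hJ'⟩ := hχ.exists_commutator_mem hG a g haa hirr fun n m hnm => hag n m hnm.ne
  obtain ⟨n, hn⟩ := hJ.nonempty
  obtain ⟨m, hmJ, hnm⟩ := hJ.exists_gt n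
  have h1 := hJ' n hn m hmJ
  let c : ℕ → pairCenter x y := fun n => ⟨_, h.commutator_mem n⟩
  have h2 : ⁅a n, g n⁆⁻¹ * ⁅a m, g m⁆ = ((c n ^ e n)⁻¹ * c m ^ e m : pairCenter x y) := by
    rw [hgc, hgc]; rfl
  rw [h2] at h1
  have h3 := key _ (Subtype.property _) h1
  have hcp : ∀ n, c n ^ (p n : ℤ) = 1 := fun n => by
    rw [zpow_natCast, ← hc n]
    exact Subtype.ext (pow_orderOf_eq_one _)
  -- Raising to the power p_n removes `c n`; as p_m does not divide e_m p_n, ψ would be trivial on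
  -- `c m`.
  have h4 : ψ (c m) ^ (e m * p n) = 1 := by
    have h5 : (ψ ((c n ^ e n)⁻¹ * c m ^ e m)) ^ (p n : ℤ) = 1 := by
      rw [show ψ ((c n ^ e n)⁻¹ * c m ^ e m) = 1 from h3, one_zpow]
    rw [← map_zpow, mul_zpow, inv_zpow, ← zpow_mul, mul_comm (e n), zpow_mul, hcp, one_zpow, inv_one,
      one_mul, ← zpow_mul, map_zpow] at h5
    exact h5
  have h5 : ψ (c m) ^ (p m : ℤ) = 1 := by rw [← map_zpow, hcp, map_one]
  have hpm := Nat.prime_iff_prime_int.mp (hp m)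
  have h6 : ¬ (p m : ℤ) ∣ e m * p n := fun h6 => by
    rcases hpm.dvd_or_dvd h6 with h7 | h7
    · exact he m h7
    · exact hnm.ne' (hinj ((Nat.prime_dvd_prime_iff_eq (hp m) (hp n)).mp
        (Int.natCast_dvd_natCast.mp h7)))
  obtain ⟨s, t, hst⟩ := hpm.coprime_iff_not_dvd.mpr h6
  apply hψ m
  change ψ (c m) = 1
  rw [← zpow_one (ψ (c m)), ← hst, zpow_add, mul_comm s, mul_comm t, zpow_mul, zpow_mul, h4, h5,
    one_zpow, one_zpow, one_mul]

/-- Each step picks a pair whose commutator order has an odd prime factor p absent from the orders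
used before, which also makes the indices distinct. Raising `x n` to the order divided by p leaves a
commutator of order p. -/
theorem exists_injective_primes (h : CentralPairs x y) (hfin : ∀ n, IsOfFinOrder ⁅x n, y n⁆)
    (hinf : {p | p.Prime ∧ ∃ n, p ∣ orderOf ⁅x n, y n⁆}.Infinite) :
    ∃ (x' y' : ℕ → G) (p : ℕ → ℕ), CentralPairs x' y' ∧ (∀ n, (p n).Prime) ∧ (∀ n, p n ≠ 2) ∧
      Function.Injective p ∧ ∀ n, orderOf ⁅x' n, y' n⁆ = p n := by
  classical
  obtain ⟨f, hf⟩ := exists_seq_of_forall_finset (α := ℕ × ℕ)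
    (fun s t => t.2.Prime ∧ t.2 ≠ 2 ∧ t.2 ∣ orderOf ⁅x t.1, y t.1⁆ ∧
      ∀ r ∈ s, ¬ t.2 ∣ orderOf ⁅x r.1, y r.1⁆) (fun s => by
        obtain ⟨p, ⟨hp, n, hn⟩, hps⟩ := hinf.exists_notMem_finset
          (insert 2 (s.biUnion fun r => (orderOf ⁅x r.1, y r.1⁆).primeFactors))
        refine ⟨(n, p), hp, ?_, hn, fun r hr hpr => hps (Finset.mem_insert_of_mem
          (Finset.mem_biUnion.mpr ⟨r, hr, Nat.mem_primeFactors.mpr ⟨hp, hpr, ?_⟩⟩))⟩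
        · rintro rfl
          exact hps (Finset.mem_insert_self _ _)
        · exact (hfin r.1).orderOf_pos.ne')
  have hlt : ∀ m n, m < n → ¬ (f n).2 ∣ orderOf ⁅x (f m).1, y (f m).1⁆ := fun m n hmn =>
    (hf n).2.2.2 _ (Finset.mem_image_of_mem f (Finset.mem_range.mpr hmn))
  have h1 : Function.Injective fun n => (f n).1 := fun m n hmn => by
    have hmn : (f m).1 = (f n).1 := hmn
    rcases lt_trichotomy m n with h | h | h
    · exact absurd (hmn ▸ (hf n).2.2.1) (hlt m n h)
    · exact h
    · exact absurd (hmn ▸ (hf m).2.2.1) (hlt n m h)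
  have h2 : Function.Injective fun n => (f n).2 := fun m n hmn => by
    have hmn : (f m).2 = (f n).2 := hmn
    rcases lt_trichotomy m n with h | h | h
    · exact absurd (hmn ▸ (hf m).2.2.1) (hlt m n h)
    · exact h
    · exact absurd (hmn ▸ (hf n).2.2.1) (hlt n m h)
  have h3 : ∀ n, orderOf (⁅x (f n).1, y (f n).1⁆ ^ (orderOf ⁅x (f n).1, y (f n).1⁆ / (f n).2)) =
      (f n).2 := fun n => orderOf_pow_orderOf_div (hfin _).orderOf_pos.ne' (hf n).2.2.1
  have h4 := h.comp h1
  have h5 := h4.pow (fun n => orderOf ⁅x (f n).1, y (f n).1⁆ / (f n).2) (fun n hn => by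
    have h6 := h3 n
    have h7 : ⁅x (f n).1, y (f n).1⁆ ^ (orderOf ⁅x (f n).1, y (f n).1⁆ / (f n).2) = 1 := hn
    rw [h7, orderOf_one] at h6
    exact (hf n).1.ne_one h6.symm)
  refine ⟨_, _, fun n => (f n).2, h5, fun n => (hf n).1, fun n => (hf n).2.1, h2, fun n => ?_⟩
  rw [h4.commutator_pow]
  exact h3 n

end CentralPairs

theorem IsTame.finite_commutator {χ : Subgroup G → Prop} (hχ : IsTame χ)
    (hG : AntichainCondition G χ) (hFC : ∀ g : G, (conjugatesOf g).Finite) :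
    Finite (_root_.commutator G) := by
  by_contra hinf
  obtain ⟨x, y, h, hinj⟩ := exists_centralPairs hχ hG hFC hinf
  have hfin := h.isOfFinOrder hFC
  by_cases hP : {p | p.Prime ∧ ∃ n, p ∣ orderOf ⁅x n, y n⁆}.Infinite
  · obtain ⟨x', y', p, h', hp, hp2, hpinj, hc⟩ := h.exists_injective_primes hfin hP
    exact h'.false_of_injective_primes hχ hG hp hp2 hpinj hc
  · rw [Set.not_infinite] at hP
    exact h.false_of_finite_primes hχ hG hinj hfin hP.toFinset fun n p hp hpn =>
      hP.mem_toFinset.mpr ⟨hp, n, hpn⟩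

/-- Pairs taken in the centralizer of the finite derived subgroup have central commutators, and by
pigeonhole infinitely many share one commutator. Quotients carry no information then, but the almost
normal case puts a single commutator power in the span of the block products. -/
theorem finiteIndex_center_of_isAlmostNormal (hG : AntichainCondition G IsAlmostNormal)
    (hFC : ∀ g : G, (conjugatesOf g).Finite) [Finite (commutator G)] :
    (Subgroup.center G).FiniteIndex := by
  classical
  by_contra hcen
  have hC₀ : (Subgroup.centralizer (commutator G : Set G)).FiniteIndex :=
    finiteIndex_centralizer_of_finite (Set.toFinite _) fun g _ => hFC g
  obtain ⟨x, y, h, hx, hy, -⟩ := exists_commutingPairs hFC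
    (Subgroup.centralizer (commutator G : Set G)) (fun _ _ => True) (fun C _ s => by
      by_contra! hcon
      refine hcen (finiteIndex_center_of_finiteIndex hFC C fun x hx y hy => ?_)
      by_contra hxy
      exact hcon x hx y hy (fun h => hxy (commutatorElement_eq_one_iff_commute.mp h)))
  have hmem : ∀ n, ⁅x n, y n⁆ ∈ commutator G := fun n =>
    Subgroup.commutator_mem_commutator (Subgroup.mem_top _) (Subgroup.mem_top _)
  have hcp : CentralPairs x y := h.centralPairs
    (fun n => Subgroup.mem_centralizer_iff.mp (hx n) _ (hmem n))
    (fun n => Subgroup.mem_centralizer_iff.mp (hy n) _ (hmem n))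
  obtain ⟨c, hc⟩ := (Set.infinite_univ (α := ℕ)).exists_infinite_fiber
    fun n => (⟨_, hmem n⟩ : commutator G)
  set f := Nat.nth (· ∈ {n | n ∈ Set.univ ∧ (⟨_, hmem n⟩ : commutator G) = c})
  have hfinj : Function.Injective f := Nat.nth_injective hc
  have hfc : ∀ n, ⁅x (f n), y (f n)⁆ = c := fun n =>
    congrArg Subtype.val (Nat.nth_mem_of_infinite hc n).2
  replace hcp := hcp.comp hfinj
  have := hcp.isMulCommutative
  have hcc : ∀ n, pairCommutator (x ∘ f) (y ∘ f) n = pairCommutator (x ∘ f) (y ∘ f) 0 := fun n =>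
    Subtype.ext ((hfc n).trans (hfc 0).symm)
  have hq := Nat.minFac_prime (n := orderOf (pairCommutator (x ∘ f) (y ∘ f) 0))
    (fun h1 => hcp.ne 0 (congrArg Subtype.val (orderOf_eq_one_iff.mp h1)))
  set q := (orderOf (pairCommutator (x ∘ f) (y ∘ f) 0)).minFac
  obtain ⟨ψ, -, hψ⟩ := RatChar.exists_extension 1 ⊥ (pairCommutator (x ∘ f) (y ∘ f) 0) hq
    (fun i hi => (Int.natCast_dvd_natCast.mpr (Nat.minFac_dvd _)).trans
      (orderOf_dvd_iff_zpow_eq_one.mpr (Subgroup.mem_bot.mp hi)))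
  -- One character ψ suffices for the common commutator, so two elements per block are enough to
  -- annihilate the product while some exponent stays prime to q.
  choose i e he hie hi using fun n : ℕ => exists_block (x := x ∘ f) (y := y ∘ f) hq
    {2 * n, 2 * n + 1} {ψ} (by rw [Finset.card_singleton, Finset.card_pair (by omega)]; omega)
  have hne : ∀ n, ψ (pairCommutator (x ∘ f) (y ∘ f) (e n) ^ i n (e n)) ≠ 1 := fun n h1 =>
    hie n (hψ _ (hcc (e n) ▸ h1))
  have hb : Blocks (x ∘ f) (y ∘ f) (fun n => {2 * n, 2 * n + 1}) i e := by
    refine ⟨fun m n hmn => ?_, he, fun n h1 => hne n ?_⟩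
    · simp only [Finset.disjoint_left, Finset.mem_insert, Finset.mem_singleton]
      omega
    · have h2 : pairCommutator (x ∘ f) (y ∘ f) (e n) ^ i n (e n) = 1 := Subtype.ext h1
      rw [h2, map_one]
  obtain ⟨n, hn⟩ := exists_commutator_mem_of_isAlmostNormal hG
    (fun n => ((∏ k ∈ ({2 * n, 2 * n + 1} : Finset ℕ), pairElement (x ∘ f) (y ∘ f) k ^ i n k :
      pairSubgroup (x ∘ f) (y ∘ f)) : G)) (fun n => (y ∘ f) (e n))
    (fun m n => by
      have h1 := mul_comm
        (∏ k ∈ ({2 * m, 2 * m + 1} : Finset ℕ), pairElement (x ∘ f) (y ∘ f) k ^ i m k)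
        (∏ k ∈ ({2 * n, 2 * n + 1} : Finset ℕ), pairElement (x ∘ f) (y ∘ f) k ^ i n k)
      exact Subtype.ext_iff.mp h1)
    (fun n => hb.notMem_closure hcp n) (fun m n hmn => hb.commute hcp hmn.ne)
  rw [hb.commutator hcp] at hn
  exact hne n (Blocks.apply_eq_one ψ (fun n => hi n ψ (Finset.mem_singleton_self _)) hn)

end DistinctPrimes

theorem mainTheorem9 (G : Type*) [Group G]
    (hrank : ℵ₀ ≤ totalRank (Subgroup.center (fcCenter G))) :
    (AntichainCondition G IsAlmostNormal → IsCentralByFinite G) ∧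
    (AntichainCondition G IsNearlyNormal → IsFiniteByAbelian G) := by
  refine ⟨fun hG => ?_, fun hG => ?_⟩
  · have hFC := isTame_isAlmostNormal.finite_conjugatesOf hG hrank
    have := isTame_isAlmostNormal.finite_commutator hG hFC
    have := finiteIndex_center_of_isAlmostNormal hG hFC
    change Finite (G ⧸ Subgroup.center G)
    infer_instance
  · have hFC := isTame_isNearlyNormal.finite_conjugatesOf hG hrank
    have := isTame_isNearlyNormal.finite_commutator hG hFC
    exact ⟨commutator G, inferInstance, this, fun a b => mul_comm (G := Abelianization G) a b⟩
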